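/- For all real $C,\varepsilon>0$ there is $D_0$ such that the following holds for every $D\ge D_0$. Let $G_1,\dots,G_m$ be (simple, not necessarily finite) graphs of maximum degree at most $D$ that are nearly disjoint, i.e. $|V(G_i)\cap V(G_j)|\le 1$ for all distinct $i,j\in\{1,\dots,m\}$, and suppose that every vertex $v\in\bigcup_{i=1}^m V(G_i)$ is contained in at most $C$ of the sets $V(G_1),\dots,V(G_m)$. Then $$\chi_\ell\Big(\bigcup_{i=1}^m G_i\Big)\le(1+\varepsilon)D.$$ Here $\bigcup_i G_i$ is the graph with vertex set $\bigcup_i V(G_i)$ and edge set $\bigcup_i E(G_i)$, and $\chi_\ell(G)$ is the minimum $k\in\mathbb N$ such that for every assignment $L$ of finite sets of colors to the vertices of $G$ with $|L(v)|\ge k$ for all $v\in V(G)$, there is a proper coloring $\varphi$ of $G$ with $\varphi(v)\in L(v)$ for all $v\in V(G)$. -/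

import Mathlib

open scoped ENNReal

namespace SimpleGraph

universe u

/-- `G` has an `L`-coloring: a proper coloring whose color at every vertex `v` lies in `L v`. -/
def ListColorable {V : Type u} (G : SimpleGraph V) {α : Type u} (L : V → Finset α) : Prop :=
  ∃ φ : G.Coloring α, ∀ v, φ v ∈ L v

/-- `G` is `L`-colorable for every assignment `L` of finite lists of size at least `k`.
The colors range over all types in the universe of `V`; at most `max |V| ℵ₀` colors can occur
in the lists, so no list assignment is lost by this. -/
def Choosable {V : Type u} (G : SimpleGraph V) (k : ℕ) : Prop :=
  ∀ (α : Type u) (L : V → Finset α), (∀ v, k ≤ (L v).card) → G.ListColorable L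

/-- The list chromatic number: the least `k` such that `G` is `L`-colorable whenever all lists
have size at least `k` (`⊤` if there is no such `k`). -/
noncomputable def listChromaticNumber {V : Type u} (G : SimpleGraph V) : ℕ∞ :=
  ⨅ k ∈ {k : ℕ | G.Choosable k}, (k : ℕ∞)

/-- The supremum of the vertex degrees (`⊤` if the degrees are unbounded). -/
noncomputable def Subgraph.eMaxDegree {V : Type u} {G : SimpleGraph V} (H : G.Subgraph) : ℕ∞ :=
  ⨆ v ∈ H.verts, (H.neighborSet v).encard

/-- Any two distinct members of the family share at most one vertex. A graph whose vertices form
a subset of `V` is a subgraph of the complete graph on `V`. -/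
def NearlyDisjoint {V : Type u} {m : ℕ} (G : Fin m → (⊤ : SimpleGraph V).Subgraph) : Prop :=
  ∀ i j, i ≠ j → ((G i).verts ∩ (G j).verts).encard ≤ 1

end SimpleGraph

/-! The proof is a semi-random (nibble) coloring. Every uncolored vertex `v` carries a probability
distribution `x v` on colors, at first uniform on `k = ⌊(1+ε)D⌋` colors of its list. The controlled
quantity is the color degree inside a single graph: the sum of `x u c` over the neighbors `u` of `v`
in `G_i`. At first it is at most `D/k ≤ 1-η` for some `η > 0`; the color degree in the union may be
`C` times larger.

In a round with small rate `p`, the color `c` is proposed at `v` with probability `p * x v c`,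
independently for all pairs. A proposal removes its color from all neighbors, and a vertex keeps a
proposed color that is not removed. Surviving weights are divided by their survival probability, so
the total weight at a vertex has expectation 1 and is renormalized after concentration.

If `u` stays uncolored and keeps `c`, then either nothing was proposed at `u`, or some proposal at
`u` was also made at a neighbor. The latter is of order `p²`. In the former case only removals of
`c` along edges outside `G_i` are taken into account; ignoring those inside `G_i` costs a factor of
at most `1/(1-pρ)`, where `ρ` bounds the color degree. Hence `ρ` turns into about `ρ e^{-p}/(1-pρ) ≈
ρ(1-p(1-ρ))`, a decrease by a constant factor because `ρ ≤ 1-η`. The ignored removals are exactly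
those that would spoil concentration, since one vertex can be adjacent to many vertices of its own
`G_i`. For the others, near disjointness shows that a proposal affects at most `C` neighbors of `v`
(`card_outerBlockers_le`). The conflicts are controlled by an exponential moment computed color by
color (`prob_le_conflictWeight`).

The local lemma makes all these estimates hold at once (`exists_outcome`), which gives
`exists_next`. After a bounded number of rounds the color degree in the union is at most `1/16`, and
independent random colors work by the local lemma (`hasWeightedColoring_of_small`). Infinite graphs
follow by compactness (`listColorable_of_finite`). -/

namespace ProductExpectation

/-! ### Expectation, independence and the local lemma on finite products. -/

open Function

variable {I β : Type*} [Fintype I] [DecidableEq I] [Fintype β]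

/-- A family of probability weights, one on `β` for every coordinate in `I`. -/
structure IsProbWeight (μ : I → β → ℝ) : Prop where
  nonneg : ∀ i b, 0 ≤ μ i b
  sum_eq_one : ∀ i, ∑ b, μ i b = 1

/-- The expectation of `f` when the coordinates are independent with laws `μ i`. -/
def expect (μ : I → β → ℝ) (f : (I → β) → ℝ) : ℝ := ∑ ω, (∏ i, μ i (ω i)) * f ω

/-- Integrating out the coordinate `a`. -/
def average (μ : I → β → ℝ) (a : I) (f : (I → β) → ℝ) : (I → β) → ℝ :=
  fun ω => ∑ b, μ a b * f (update ω a b)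

variable {μ : I → β → ℝ}

set_option linter.unusedSectionVars false

lemma weight_nonneg (hμ : IsProbWeight μ) (ω : I → β) : 0 ≤ ∏ i, μ i (ω i) :=
  Finset.prod_nonneg fun i _ => hμ.nonneg i _

lemma expect_mono (hμ : IsProbWeight μ) {f g : (I → β) → ℝ} (h : ∀ ω, f ω ≤ g ω) :
    expect μ f ≤ expect μ g :=
  Finset.sum_le_sum fun ω _ => mul_le_mul_of_nonneg_left (h ω) (weight_nonneg hμ ω)

lemma expect_nonneg (hμ : IsProbWeight μ) {f : (I → β) → ℝ} (h : ∀ ω, 0 ≤ f ω) :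
    0 ≤ expect μ f :=
  Finset.sum_nonneg fun ω _ => mul_nonneg (weight_nonneg hμ ω) (h ω)

lemma expect_add (f g : (I → β) → ℝ) :
    expect μ (fun ω => f ω + g ω) = expect μ f + expect μ g := by
  simp only [expect, mul_add, Finset.sum_add_distrib]

lemma expect_const_mul (r : ℝ) (f : (I → β) → ℝ) :
    expect μ (fun ω => r * f ω) = r * expect μ f := by
  simp only [expect, Finset.mul_sum]
  exact Finset.sum_congr rfl fun ω _ => by ring

lemma expect_sum {κ : Type*} (s : Finset κ) (f : κ → (I → β) → ℝ) :
    expect μ (fun ω => ∑ k ∈ s, f k ω) = ∑ k ∈ s, expect μ (f k) := by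
  simp only [expect, Finset.mul_sum]
  exact Finset.sum_comm

lemma expect_prod (g : I → β → ℝ) :
    expect μ (fun ω => ∏ i, g i (ω i)) = ∏ i, ∑ b, μ i b * g i b := by
  rw [Finset.prod_univ_sum, Fintype.piFinset_univ]
  simp only [expect, Finset.prod_mul_distrib]

lemma expect_const (hμ : IsProbWeight μ) (r : ℝ) : expect μ (fun _ => r) = r := by
  have h := expect_prod (μ := μ) (fun _ _ => (1 : ℝ))
  simp only [Finset.prod_const_one, mul_one, hμ.sum_eq_one] at h
  have := expect_const_mul (μ := μ) r (fun _ => 1)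
  simpa [h] using this

/-- Resampling coordinate `a` is measure preserving: swapping `ω a` with a fresh sample is an
involution that preserves the joint weight. -/
lemma expect_average (hμ : IsProbWeight μ) (a : I) (f : (I → β) → ℝ) :
    expect μ (average μ a f) = expect μ f := by
  have hinv : Involutive (fun y : (I → β) × β => (update y.1 a y.2, y.1 a)) := by
    rintro ⟨ω, b⟩
    simp
  have key : ∀ (ω : I → β) (b : β),
      (∏ i, μ i (update ω a b i)) * μ a (ω a) = (∏ i, μ i (ω i)) * μ a b := by
    intro ω b
    rw [← Finset.mul_prod_erase _ _ (Finset.mem_univ a),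
      ← Finset.mul_prod_erase _ (fun i => μ i (ω i)) (Finset.mem_univ a)]
    have : ∏ i ∈ Finset.univ.erase a, μ i (update ω a b i)
        = ∏ i ∈ Finset.univ.erase a, μ i (ω i) :=
      Finset.prod_congr rfl fun i hi => by rw [update_of_ne (Finset.ne_of_mem_erase hi)]
    rw [this, update_self]
    ring
  have h1 : expect μ f
      = ∑ y : (I → β) × β, (∏ i, μ i (y.1 i)) * μ a y.2 * f y.1 := by
    rw [Fintype.sum_prod_type]
    refine Finset.sum_congr rfl fun ω _ => ?_
    simp only [← Finset.sum_mul, ← Finset.mul_sum, hμ.sum_eq_one, mul_one]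
  rw [h1, ← Equiv.sum_comp hinv.toPerm, Fintype.sum_prod_type]
  refine Finset.sum_congr rfl fun ω _ => ?_
  simp only [average, Finset.mul_sum, Involutive.coe_toPerm]
  refine Finset.sum_congr rfl fun b _ => ?_
  rw [key]
  ring

lemma average_dependsOn {f : (I → β) → ℝ} {S : Set I} (hf : DependsOn f S) (a : I) :
    DependsOn (average μ a f) (S \ {a}) := by
  intro ω ω' h
  refine Finset.sum_congr rfl fun b _ => ?_
  congr 1
  refine hf fun i hi => ?_
  by_cases hia : i = a
  · subst hia; simp
  · simp only [update_of_ne hia]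
    exact h i ⟨hi, hia⟩

lemma expect_of_dependsOn_empty (hμ : IsProbWeight μ) {f : (I → β) → ℝ}
    (hf : DependsOn f ∅) (ω : I → β) : expect μ f = f ω := by
  have : f = fun _ => f ω := funext fun ω' => hf.empty _ _
  conv_lhs => rw [this]
  exact expect_const hμ _

/-- Functions of disjoint sets of coordinates are independent. -/
lemma expect_mul_of_disjoint (hμ : IsProbWeight μ) {f g : (I → β) → ℝ} {S T : Set I}
    (hf : DependsOn f S) (hg : DependsOn g T) (hST : Disjoint S T) :
    expect μ (fun ω => f ω * g ω) = expect μ f * expect μ g := by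
  classical
  -- Averaging over the coordinates of `S` one at a time makes `f` constant; since `g` ignores these
  -- coordinates, neither `E f` nor `E (f g)` changes.
  have key : ∀ J : Finset I, (J : Set I) ⊆ S → ∃ f' : (I → β) → ℝ,
      DependsOn f' (S \ J) ∧ expect μ f' = expect μ f ∧
        expect μ (fun ω => f' ω * g ω) = expect μ (fun ω => f ω * g ω) := by
    intro J
    induction J using Finset.induction_on with
    | empty => exact fun _ => ⟨f, by simpa using hf, rfl, rfl⟩
    | insert a J _ ih =>
      intro hJ
      obtain ⟨f', h1, h2, h3⟩ := ih fun i hi => hJ (by simp [Finset.mem_coe.mp hi])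
      refine ⟨average μ a f', ?_, ?_, ?_⟩
      · refine (average_dependsOn h1 a).mono ?_
        intro i hi
        simp only [Set.mem_sdiff, Set.mem_singleton_iff, Finset.mem_coe, Finset.mem_insert] at *
        tauto
      · rw [expect_average hμ, h2]
      · rw [← h3, ← expect_average hμ a (fun ω => f' ω * g ω)]
        congr 1
        funext ω
        simp only [average, Finset.sum_mul]
        refine Finset.sum_congr rfl fun b _ => ?_
        have : g (update ω a b) = g ω := hg fun i hi => by
          have : i ≠ a := fun h => Set.disjoint_left.mp hST (hJ (by simp)) (h ▸ hi)
          rw [update_of_ne this]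
        rw [this]
        ring
  obtain ⟨f', h1, h2, h3⟩ := key S.toFinset (by simp)
  have h1' : DependsOn f' ∅ := h1.mono (by simp)
  rw [← h3, ← h2]
  rcases isEmpty_or_nonempty (I → β) with hE | ⟨⟨ω₀⟩⟩
  · simp [expect]
  · rw [expect_of_dependsOn_empty hμ h1' ω₀, ← expect_const_mul]
    congr 1
    funext ω
    rw [h1'.empty ω ω₀]

/-- Functions of pairwise disjoint blocks of coordinates are independent. -/
lemma expect_prod_of_pairwise_disjoint {κ : Type*} (hμ : IsProbWeight μ) (s : Finset κ)
    (f : κ → (I → β) → ℝ) (S : κ → Set I) (hf : ∀ k, DependsOn (f k) (S k))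
    (hS : Pairwise (Disjoint on S)) :
    expect μ (fun ω => ∏ k ∈ s, f k ω) = ∏ k ∈ s, expect μ (f k) := by
  classical
  induction s using Finset.induction_on with
  | empty => simpa using expect_const hμ 1
  | insert a s ha ih =>
    simp only [Finset.prod_insert ha]
    rw [← ih]
    refine expect_mul_of_disjoint (T := ⋃ k ∈ s, S k) hμ (hf a) ?_ ?_
    · intro ω ω' h
      refine Finset.prod_congr rfl fun k hk => hf k fun i hi => h i ?_
      exact Set.mem_biUnion (Finset.mem_coe.mpr hk) hi
    · simp only [Set.disjoint_iUnion_right]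
      exact fun k hk => hS fun h => ha (h ▸ hk)

/-! ### Probabilities -/

/-- The probability of an event. -/
noncomputable def prob (μ : I → β → ℝ) (A : Set (I → β)) : ℝ := expect μ (A.indicator 1)

lemma prob_nonneg (hμ : IsProbWeight μ) (A : Set (I → β)) : 0 ≤ prob μ A :=
  expect_nonneg hμ fun ω => Set.indicator_nonneg (fun _ _ => zero_le_one) ω

lemma prob_mono (hμ : IsProbWeight μ) {A B : Set (I → β)} (h : A ⊆ B) : prob μ A ≤ prob μ B :=
  expect_mono hμ fun ω => Set.indicator_le_indicator_of_subset h (fun _ => zero_le_one) ω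

lemma prob_union_le (hμ : IsProbWeight μ) (A B : Set (I → β)) :
    prob μ (A ∪ B) ≤ prob μ A + prob μ B := by
  rw [prob, prob, prob, ← expect_add]
  refine expect_mono hμ fun ω => ?_
  by_cases hA : ω ∈ A <;> by_cases hB : ω ∈ B <;> simp [hA, hB]

lemma indicator_dependsOn {A : Set (I → β)} {S : Set I} (h : DependsOn (· ∈ A) S) :
    DependsOn (A.indicator (1 : (I → β) → ℝ)) S := by
  intro ω ω' hω
  have := h hω
  simp only [eq_iff_iff] at this
  by_cases hA : ω ∈ A
  · simp [hA, this.mp hA]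
  · rw [Set.indicator_of_notMem hA, Set.indicator_of_notMem fun h' => hA (this.mpr h')]

lemma prob_inter_of_disjoint (hμ : IsProbWeight μ) {A B : Set (I → β)} {S T : Set I}
    (hA : DependsOn (· ∈ A) S) (hB : DependsOn (· ∈ B) T) (hST : Disjoint S T) :
    prob μ (A ∩ B) = prob μ A * prob μ B := by
  rw [prob, prob, prob, ← expect_mul_of_disjoint hμ (indicator_dependsOn hA)
    (indicator_dependsOn hB) hST]
  congr 1
  funext ω
  simp [Set.inter_indicator_one]

/-- The exponential Markov inequality. -/
lemma prob_le_of_expect_exp_le (hμ : IsProbWeight μ) {f : (I → β) → ℝ} {s t b : ℝ} (hs : 0 ≤ s)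
    (h : expect μ (fun ω => Real.exp (s * f ω)) ≤ Real.exp b) :
    prob μ {ω | t ≤ f ω} ≤ Real.exp (b - s * t) := by
  have h1 : prob μ {ω | t ≤ f ω} ≤ expect μ (fun ω => Real.exp (-(s * t)) * Real.exp (s * f ω)) := by
    refine expect_mono hμ fun ω => ?_
    rw [← Real.exp_add]
    by_cases hω : t ≤ f ω
    · have : 0 ≤ s * (f ω - t) := mul_nonneg hs (by linarith)
      simp only [Set.indicator, Set.mem_ofPred_eq, hω, if_true, Pi.one_apply]
      exact Real.one_le_exp (by linarith)
    · simp only [Set.indicator, Set.mem_ofPred_eq, hω, if_false]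
      positivity
  rw [expect_const_mul] at h1
  refine h1.trans ?_
  rw [sub_eq_add_neg, add_comm, Real.exp_add]
  gcongr

/-! ### The local lemma -/

/-- The Lovász local lemma for events determined by finitely many independent coordinates: if the
probabilities of the events sharing a coordinate with a given one add up to at most `1 / 4`, then
all events can be avoided at once. -/
theorem exists_avoiding_all {κ : Type*} (hμ : IsProbWeight μ) (A : κ → Set (I → β))
    (S : κ → Set I) (T : Finset κ) (hdep : ∀ k ∈ T, DependsOn (· ∈ A k) (S k))
    (hprob : ∀ k ∈ T, prob μ (A k) ≤ 1 / 4)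
    (hsum : ∀ k ∈ T, ∀ T' ⊆ T, (∀ l ∈ T', ¬ Disjoint (S k) (S l)) →
      ∑ l ∈ T', prob μ (A l) ≤ 1 / 4) :
    ∃ ω, 0 < ∏ i, μ i (ω i) ∧ ∀ k ∈ T, ω ∉ A k := by
  classical
  let good : Finset κ → Set (I → β) := fun T' => {ω | ∀ k ∈ T', ω ∉ A k}
  have hgooddep : ∀ T' ⊆ T, DependsOn (· ∈ good T') (⋃ k ∈ T', S k) := by
    intro T' hT' ω ω' h
    simp only [good, Set.mem_ofPred_eq, eq_iff_iff]
    refine forall₂_congr fun k hk => not_congr ?_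
    exact iff_of_eq (hdep k (hT' hk) fun i hi => h i (Set.mem_biUnion (Finset.mem_coe.mpr hk) hi))
  -- The usual bound `P(A k | good T') ≤ 2 P(A k)`, multiplied out so that no positivity is needed
  -- yet.
  have key : ∀ T' ⊆ T, ∀ k ∈ T, prob μ (A k ∩ good T') ≤ 2 * prob μ (A k) * prob μ (good T') := by
    intro T'
    induction T' using Finset.strongInduction with
    | H T' ih =>
      intro hT' k hk
      set T₁ := T'.filter fun l => ¬ Disjoint (S k) (S l) with hT₁
      set T₂ := T'.filter fun l => Disjoint (S k) (S l) with hT₂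
      have hT₂T : T₂ ⊆ T := (Finset.filter_subset _ _).trans hT'
      have hT₁T : T₁ ⊆ T := (Finset.filter_subset _ _).trans hT'
      have hind : prob μ (A k ∩ good T₂) = prob μ (A k) * prob μ (good T₂) := by
        refine prob_inter_of_disjoint hμ (hdep k hk) (hgooddep T₂ hT₂T) ?_
        simp only [Set.disjoint_iUnion_right]
        exact fun l hl => (Finset.mem_filter.mp hl).2
      have hle : prob μ (A k ∩ good T') ≤ prob μ (A k) * prob μ (good T₂) := by
        rw [← hind]
        refine prob_mono hμ (Set.inter_subset_inter_right _ fun ω hω l hl => hω l ?_)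
        exact Finset.filter_subset _ _ hl
      have hlow : prob μ (good T₂) ≤ 2 * prob μ (good T') := by
        by_cases hne : T₂ = T'
        · rw [hne]
          linarith [prob_nonneg hμ (good T')]
        · have hss : T₂ ⊂ T' := (Finset.filter_subset _ _).ssubset_of_ne hne
          -- Given `good T₂`, the dependent events of `T₁` have total probability at most `2 *
          -- (1/4)` by induction, so at least half of `good T₂` survives in `good T'`.
          have h1 : prob μ (good T₂) ≤ prob μ (good T') + ∑ l ∈ T₁, prob μ (A l ∩ good T₂) := by
            simp only [prob]
            rw [← expect_sum, ← expect_add]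
            refine expect_mono hμ fun ω => ?_
            have hnn : ∀ l ∈ T₁, (0 : ℝ) ≤ (A l ∩ good T₂).indicator 1 ω := fun l _ =>
              Set.indicator_nonneg (fun _ _ => zero_le_one) ω
            by_cases h2 : ω ∈ good T₂
            · by_cases h' : ω ∈ good T'
              · simp only [Set.indicator_of_mem h2, Set.indicator_of_mem h']
                linarith [Finset.sum_nonneg hnn]
              · have : ∃ l ∈ T', ω ∈ A l := by
                  simpa [good] using h'
                obtain ⟨l, hl, hωl⟩ := this
                have hl1 : l ∈ T₁ := by
                  refine Finset.mem_filter.mpr ⟨hl, fun hd => ?_⟩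
                  exact h2 l (Finset.mem_filter.mpr ⟨hl, hd⟩) hωl
                have := Finset.single_le_sum hnn hl1
                rw [Set.indicator_of_mem (show ω ∈ A l ∩ good T₂ from ⟨hωl, h2⟩)] at this
                simp only [Set.indicator_of_mem h2, Set.indicator_of_notMem h']
                linarith
            · rw [Set.indicator_of_notMem h2]
              have := Set.indicator_nonneg (s := good T') (f := (1 : (I → β) → ℝ))
                (fun _ _ => zero_le_one) ω
              linarith [Finset.sum_nonneg hnn]
          have h2 : ∑ l ∈ T₁, prob μ (A l ∩ good T₂)
              ≤ ∑ l ∈ T₁, 2 * prob μ (A l) * prob μ (good T₂) :=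
            Finset.sum_le_sum fun l hl => ih T₂ hss hT₂T l (hT₁T hl)
          have h3 : ∑ l ∈ T₁, prob μ (A l) ≤ 1 / 4 :=
            hsum k hk T₁ hT₁T fun l hl => (Finset.mem_filter.mp hl).2
          rw [← Finset.sum_mul, ← Finset.mul_sum] at h2
          nlinarith [prob_nonneg hμ (good T₂)]
      nlinarith [prob_nonneg hμ (A k)]
  have hpos : ∀ T' ⊆ T, 0 < prob μ (good T') := by
    intro T'
    induction T' using Finset.induction_on with
    | empty =>
      intro _
      have : good ∅ = Set.univ := by simp [good]
      rw [this, prob, Set.indicator_univ]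
      exact (expect_const hμ 1).symm ▸ one_pos
    | insert a T' _ ih =>
      intro hT'
      have hT'' : T' ⊆ T := (Finset.subset_insert _ _).trans hT'
      have ha : a ∈ T := hT' (Finset.mem_insert_self _ _)
      have h1 : prob μ (good T') ≤ prob μ (good (insert a T')) + prob μ (A a ∩ good T') := by
        refine (prob_mono hμ fun ω hω => ?_).trans (prob_union_le hμ _ _)
        by_cases h : ω ∈ A a
        · exact Or.inr ⟨h, hω⟩
        · refine Or.inl fun k hk => ?_
          rcases Finset.mem_insert.mp hk with rfl | hk
          · exact h
          · exact hω k hk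
      have := key T' hT'' a ha
      nlinarith [ih hT'', hprob a ha]
  by_contra hcon
  push Not at hcon
  refine (hpos T subset_rfl).ne' ?_
  refine Finset.sum_eq_zero fun ω _ => ?_
  by_cases hω : ω ∈ good T
  · have : ¬ 0 < ∏ i, μ i (ω i) := fun h => by
      obtain ⟨k, hk, hk'⟩ := hcon ω h
      exact hω k hk hk'
    rw [le_antisymm (not_lt.mp this) (weight_nonneg hμ ω), zero_mul]
  · rw [Set.indicator_of_notMem hω, mul_zero]

end ProductExpectation

/-! ### Independent bits and concentration under bounded differences. -/

namespace ProductExpectation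

open Function

variable {I : Type*} [Fintype I] [DecidableEq I]

set_option linter.unusedSectionVars false

/-- The law of independent bits, where the bit `i` is `true` with probability `q i`. -/
def bits (q : I → ℝ) : I → Bool → ℝ := fun i b => if b then q i else 1 - q i

lemma isProbWeight_bits {q : I → ℝ} (h0 : ∀ i, 0 ≤ q i) (h1 : ∀ i, q i ≤ 1) :
    IsProbWeight (bits q) where
  nonneg i b := by
    cases b
    · simpa [bits] using h1 i
    · simpa [bits] using h0 i
  sum_eq_one i := by simp [bits]

lemma expect_bits_prod (q : I → ℝ) (g : I → Bool → ℝ) :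
    expect (bits q) (fun ω => ∏ i, g i (ω i))
      = ∏ i, (q i * g i true + (1 - q i) * g i false) := by
  rw [expect_prod]
  simp [bits]

lemma expect_bits_none (q : I → ℝ) (F : Finset I) :
    expect (bits q) (fun ω => if ∀ e ∈ F, ω e = false then 1 else 0) = ∏ e ∈ F, (1 - q e) := by
  have h := expect_bits_prod q (fun i b => if i ∈ F ∧ b = true then 0 else 1)
  have h1 : (fun ω : I → Bool => if ∀ e ∈ F, ω e = false then (1 : ℝ) else 0)
      = fun ω => ∏ i, (if i ∈ F ∧ ω i = true then (0 : ℝ) else 1) := by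
    funext ω
    by_cases hω : ∀ e ∈ F, ω e = false
    · rw [if_pos hω, Finset.prod_eq_one]
      intro i _
      rw [if_neg]
      rintro ⟨hi, hi'⟩
      simp [hω i hi] at hi'
    · rw [if_neg hω]
      push Not at hω
      obtain ⟨e, he, he'⟩ := hω
      refine (Finset.prod_eq_zero (Finset.mem_univ e) ?_).symm
      rw [if_pos ⟨he, by simpa using he'⟩]
  rw [h1, h, ← Finset.prod_subset (Finset.subset_univ F)]
  · exact Finset.prod_congr rfl fun i hi => by simp [hi]
  · intro i _ hi
    simp [hi]

/-- After centering, `e^y ≤ 1 + y + y²` for `|y| ≤ 1` leaves only the variance `q(1-q)d²`, as the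
linear terms cancel. The factor `q` in the result is essential: there are many bits, each with a
tiny success probability. -/
lemma two_point_mgf_le {q a b c s : ℝ} (hq0 : 0 ≤ q) (hq1 : q ≤ 1) (hs : 0 ≤ s)
    (hab : |a - b| ≤ c) (hsc : s * c ≤ 1) :
    q * Real.exp (s * a) + (1 - q) * Real.exp (s * b)
      ≤ Real.exp (s * (q * a + (1 - q) * b) + s ^ 2 * (q * c ^ 2)) := by
  set m := q * a + (1 - q) * b with hm
  set d := s * (a - b) with hd
  have hdc : |d| ≤ s * c := by
    rw [hd, abs_mul, abs_of_nonneg hs]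
    gcongr
  have hd1 : |d| ≤ 1 := hdc.trans hsc
  have hd2 : d ^ 2 ≤ s ^ 2 * c ^ 2 := by
    rw [← mul_pow, ← sq_abs d]
    gcongr
  have e1 : s * a = s * m + (1 - q) * d := by rw [hm, hd]; ring
  have e2 : s * b = s * m + -q * d := by rw [hm, hd]; ring
  have hx1 : |(1 - q) * d| ≤ 1 := by
    rw [abs_mul, abs_of_nonneg (by linarith : 0 ≤ 1 - q)]
    nlinarith [abs_nonneg d]
  have hx2 : |-q * d| ≤ 1 := by
    rw [abs_mul, abs_neg, abs_of_nonneg hq0]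
    nlinarith [abs_nonneg d]
  have b1 := (abs_le.mp (Real.abs_exp_sub_one_sub_id_le hx1)).2
  have b2 := (abs_le.mp (Real.abs_exp_sub_one_sub_id_le hx2)).2
  have hmain : q * Real.exp ((1 - q) * d) + (1 - q) * Real.exp (-q * d)
      ≤ 1 + q * (1 - q) * d ^ 2 := by
    have h1 := mul_le_mul_of_nonneg_left b1 hq0
    have h2 := mul_le_mul_of_nonneg_left b2 (by linarith : 0 ≤ 1 - q)
    nlinarith
  have hfin : 1 + q * (1 - q) * d ^ 2 ≤ Real.exp (s ^ 2 * (q * c ^ 2)) := by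
    have h1 : q * (1 - q) * d ^ 2 ≤ q * (s ^ 2 * c ^ 2) := by
      have : q * (1 - q) ≤ q := by nlinarith
      calc q * (1 - q) * d ^ 2 ≤ q * d ^ 2 := by gcongr
        _ ≤ _ := by gcongr
    have h2 := Real.add_one_le_exp (s ^ 2 * (q * c ^ 2))
    linarith
  rw [e1, e2, Real.exp_add, Real.exp_add, Real.exp_add]
  have := mul_le_mul_of_nonneg_left (hmain.trans hfin) (Real.exp_pos (s * m)).le
  linarith

/-- A bound for the moment generating function of a function of independent bits with bounded
differences, in which every bit only contributes in proportion to its success probability. -/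
theorem expect_exp_le_of_bounded_differences {q c : I → ℝ} (h0 : ∀ i, 0 ≤ q i)
    (h1 : ∀ i, q i ≤ 1) {f : (I → Bool) → ℝ}
    (hf : ∀ ω i, |f (update ω i true) - f (update ω i false)| ≤ c i) {s : ℝ} (hs : 0 ≤ s)
    (hsc : ∀ i, s * c i ≤ 1) :
    expect (bits q) (fun ω => Real.exp (s * f ω))
      ≤ Real.exp (s * expect (bits q) f + s ^ 2 * ∑ i, q i * c i ^ 2) := by
  have hμ := isProbWeight_bits h0 h1
  have havg : ∀ a (g : (I → Bool) → ℝ) ω, average (bits q) a g ω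
      = q a * g (update ω a true) + (1 - q a) * g (update ω a false) := by
    intro a g ω
    simp [average, bits]
  -- Bits are averaged out one by one. Averaging preserves the difference bounds for the remaining
  -- bits, and each step costs the factor of `two_point_mgf_le`.
  have key : ∀ J : Finset I, ∃ g : (I → Bool) → ℝ, DependsOn g ((J : Set I)ᶜ) ∧
      expect (bits q) g = expect (bits q) f ∧
      (∀ ω i, |g (update ω i true) - g (update ω i false)| ≤ c i) ∧
      expect (bits q) (fun ω => Real.exp (s * f ω))
        ≤ Real.exp (s ^ 2 * ∑ i ∈ J, q i * c i ^ 2)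
          * expect (bits q) (fun ω => Real.exp (s * g ω)) := by
    intro J
    induction J using Finset.induction_on with
    | empty => exact ⟨f, by simpa using dependsOn_univ f, rfl, hf, by simp⟩
    | insert a J ha ih =>
      obtain ⟨g, g1, g2, g3, g4⟩ := ih
      refine ⟨average (bits q) a g, ?_, ?_, ?_, ?_⟩
      · refine (average_dependsOn g1 a).mono fun i hi => ?_
        simp only [Set.mem_sdiff, Set.mem_compl_iff, Finset.mem_coe, Set.mem_singleton_iff,
          Finset.mem_insert] at *
        tauto
      · rw [expect_average hμ, g2]
      · intro ω i
        by_cases hia : i = a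
        · subst hia
          simp only [havg, update_idem]
          rw [sub_self, abs_zero]
          exact (abs_nonneg _).trans (g3 ω i)
        · rw [havg, havg]
          have e : ∀ b b', update (update ω i b) a b' = update (update ω a b') i b :=
            fun b b' => update_comm hia _ _ _
          rw [e, e, e, e]
          have k1 := abs_le.mp (g3 (update ω a true) i)
          have k2 := abs_le.mp (g3 (update ω a false) i)
          have := h0 a
          have := h1 a
          rw [abs_le]
          constructor <;> nlinarith
      · refine g4.trans ?_
        rw [Finset.sum_insert ha, mul_add, add_comm, Real.exp_add, mul_assoc]
        refine mul_le_mul_of_nonneg_left ?_ (Real.exp_pos _).le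
        rw [← expect_average hμ a, ← expect_const_mul]
        refine expect_mono hμ fun ω => ?_
        rw [havg, havg, ← Real.exp_add, add_comm (s ^ 2 * _)]
        exact two_point_mgf_le (h0 a) (h1 a) hs (g3 ω a) (hsc a)
  obtain ⟨g, g1, g2, -, g4⟩ := key Finset.univ
  have g1' : DependsOn g ∅ := g1.mono (by simp)
  refine g4.trans (le_of_eq ?_)
  have ω₀ : I → Bool := fun _ => true
  have e1 := expect_of_dependsOn_empty hμ g1' ω₀
  have e2 := expect_of_dependsOn_empty hμ
    (f := fun ω => Real.exp (s * g ω)) (fun x y _ => congrArg (fun r => Real.exp (s * r)) (g1'.empty x y)) ω₀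
  rw [e2, ← g2, e1, ← Real.exp_add, add_comm]

/-- The tail bound for functions of independent bits with bounded differences. -/
theorem prob_expect_add_le {q c : I → ℝ} (h0 : ∀ i, 0 ≤ q i)
    (h1 : ∀ i, q i ≤ 1) {f : (I → Bool) → ℝ}
    (hf : ∀ ω i, |f (update ω i true) - f (update ω i false)| ≤ c i) {s v : ℝ} (hs : 0 ≤ s)
    (hsc : ∀ i, s * c i ≤ 1) (hv : ∑ i, q i * c i ^ 2 ≤ v) (t : ℝ) :
    prob (bits q) {ω | expect (bits q) f + t ≤ f ω} ≤ Real.exp (s ^ 2 * v - s * t) := by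
  refine (prob_le_of_expect_exp_le (isProbWeight_bits h0 h1) hs
    (expect_exp_le_of_bounded_differences h0 h1 hf hs hsc)).trans ?_
  rw [Real.exp_le_exp]
  have := mul_le_mul_of_nonneg_left hv (sq_nonneg s)
  linarith

end ProductExpectation

/-! ### Coincidences between two coordinates. -/

namespace ProductExpectation

open Function

variable {I β : Type*} [Fintype I] [DecidableEq I] [Fintype β] {μ : I → β → ℝ}

lemma expect_coordinate (hμ : IsProbWeight μ) (a : I) (g : β → ℝ) :
    expect μ (fun ω => g (ω a)) = ∑ b, μ a b * g b := by
  rw [← expect_average hμ a]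
  have h : average μ a (fun ω => g (ω a)) = fun _ => ∑ b, μ a b * g b := by
    funext ω
    simp [average]
  rw [h]
  exact expect_const hμ _

lemma prob_coordinates_eq (hμ : IsProbWeight μ) {a b : I} (hab : a ≠ b) :
    prob μ {ω | ω a = ω b} = ∑ c, μ a c * μ b c := by
  classical
  have h : Set.indicator {ω : I → β | ω a = ω b} (1 : (I → β) → ℝ)
      = fun ω => ∑ c, (if ω a = c then 1 else 0) * (if ω b = c then 1 else 0) := by
    funext ω
    simp [Set.indicator, eq_comm]
  rw [prob, h, expect_sum]
  refine Finset.sum_congr rfl fun c _ => ?_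
  rw [expect_mul_of_disjoint (S := {a}) (T := {b}) hμ]
  · rw [expect_coordinate hμ a (fun d => if d = c then 1 else 0),
      expect_coordinate hμ b (fun d => if d = c then 1 else 0)]
    simp
  · intro ω ω' h
    simp [h a rfl]
  · intro ω ω' h
    simp [h b rfl]
  · simpa using hab

end ProductExpectation

/-! ### Weighted coloring problems and the final step of the procedure. -/

namespace NibbleColoring

open Finset ProductExpectation

variable {V ι α : Type*} [Fintype V] [DecidableEq V] [Fintype ι] [DecidableEq ι]
  [Fintype α] [DecidableEq α]

lemma sum_biUnion_le {κ τ : Type*} [DecidableEq τ] {f : τ → ℝ} (hf : ∀ t, 0 ≤ f t)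
    (s : Finset κ) (F : κ → Finset τ) :
    ∑ t ∈ s.biUnion F, f t ≤ ∑ k ∈ s, ∑ t ∈ F k, f t := by
  classical
  induction s using Finset.induction_on with
  | empty => simp
  | insert a s ha ih =>
    rw [biUnion_insert, sum_insert ha]
    have h1 := sum_union_inter (s₁ := F a) (s₂ := s.biUnion F) (f := f)
    have h2 := sum_nonneg (s := F a ∩ s.biUnion F) fun t _ => hf t
    linarith

/-- `N i v` is the neighborhood of `v` in the `i`-th member of a family of nearly disjoint graphs
of maximum degree at most `D`, such that every vertex is non-isolated in at most `C` of them. -/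
structure IsNearlyDisjointFamily (N : ι → V → Finset V) (C : ℕ) (D : ℝ) : Prop where
  symm : ∀ {i u v}, u ∈ N i v → v ∈ N i u
  irrefl : ∀ i v, v ∉ N i v
  card_le : ∀ i v, ((N i v).card : ℝ) ≤ D
  index_le : ∀ v, (univ.filter fun i => (N i v).Nonempty).card ≤ C
  eq_of_shared : ∀ {i j u v}, i ≠ j → (N i u).Nonempty → (N j u).Nonempty →
    (N i v).Nonempty → (N j v).Nonempty → u = v

/-- The neighborhood of `v` in the union of the family. -/
def neighbors (N : ι → V → Finset V) (v : V) : Finset V := univ.biUnion fun i => N i v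

/-- Nonnegative color weights on the set `U` of vertices that are still to be colored, where the
weight of a color in a neighborhood inside one graph of the family is at most `ρ`. -/
structure IsWeighting (N : ι → V → Finset V) (x : V → α → ℝ) (U : Finset V) (D M K ρ : ℝ) :
    Prop where
  nonneg : ∀ v c, 0 ≤ x v c
  eq_zero : ∀ v, v ∉ U → ∀ c, x v c = 0
  sum_eq_one : ∀ v ∈ U, ∑ c, x v c = 1
  color_degree_le : ∀ i v c, 0 < x v c → ∑ u ∈ N i v, x u c ≤ ρ
  le_div : ∀ v c, x v c ≤ K / D
  support_le : ∀ v, ((univ.filter fun c => 0 < x v c).card : ℝ) ≤ M * D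

/-- `U` has a proper coloring in which every color has positive weight. -/
def HasWeightedColoring (N : ι → V → Finset V) (x : V → α → ℝ) (U : Finset V) : Prop :=
  ∃ φ : V → α, (∀ v ∈ U, 0 < x v (φ v)) ∧
    ∀ u ∈ U, ∀ v ∈ U, u ∈ neighbors N v → φ u ≠ φ v

variable {N : ι → V → Finset V} {x : V → α → ℝ} {U : Finset V} {C : ℕ} {D M K ρ : ℝ}

set_option linter.unusedSectionVars false

lemma mem_neighbors {u v : V} : u ∈ neighbors N v ↔ ∃ i, u ∈ N i v := by
  simp [neighbors]

namespace IsNearlyDisjointFamily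

lemma neighbors_symm (hN : IsNearlyDisjointFamily N C D) {u v : V} (h : u ∈ neighbors N v) :
    v ∈ neighbors N u := by
  rw [mem_neighbors] at *
  exact h.imp fun i hi => hN.symm hi

lemma notMem_neighbors (hN : IsNearlyDisjointFamily N C D) (v : V) : v ∉ neighbors N v := by
  rw [mem_neighbors]
  exact fun ⟨i, hi⟩ => hN.irrefl i v hi

lemma sum_neighbors_le (hN : IsNearlyDisjointFamily N C D) {v : V} {f : V → ℝ} {r : ℝ}
    (hf : ∀ u, 0 ≤ f u) (hr : ∀ i, ∑ u ∈ N i v, f u ≤ r) (h0 : 0 ≤ r) :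
    ∑ u ∈ neighbors N v, f u ≤ C * r := by
  have h1 : neighbors N v = (univ.filter fun i => (N i v).Nonempty).biUnion fun i => N i v := by
    ext u
    simp only [neighbors, mem_biUnion, mem_univ, true_and, mem_filter]
    exact ⟨fun ⟨i, hi⟩ => ⟨i, ⟨u, hi⟩, hi⟩, fun ⟨i, _, hi⟩ => ⟨i, hi⟩⟩
  rw [h1]
  refine (sum_biUnion_le hf _ _).trans ?_
  refine (sum_le_card_nsmul _ _ r fun i _ => hr i).trans ?_
  rw [nsmul_eq_mul]
  have := hN.index_le v
  gcongr

lemma card_neighbors_le (hN : IsNearlyDisjointFamily N C D) (hD : 0 ≤ D) (v : V) :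
    ((neighbors N v).card : ℝ) ≤ C * D := by
  have := hN.sum_neighbors_le (v := v) (f := fun _ => 1) (r := D) (fun _ => zero_le_one)
    (fun i => by simpa using hN.card_le i v) hD
  simpa using this

end IsNearlyDisjointFamily

namespace IsWeighting

lemma mem_of_pos (hx : IsWeighting N x U D M K ρ) {v : V} {c : α} (h : 0 < x v c) : v ∈ U := by
  by_contra hv
  exact h.ne' (hx.eq_zero v hv c)

lemma sum_le_one (hx : IsWeighting N x U D M K ρ) (v : V) : ∑ c, x v c ≤ 1 := by
  by_cases hv : v ∈ U
  · exact (hx.sum_eq_one v hv).le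
  · simp [hx.eq_zero v hv]

lemma le_one (hx : IsWeighting N x U D M K ρ) (v : V) (c : α) : x v c ≤ 1 :=
  (single_le_sum (fun c _ => hx.nonneg v c) (mem_univ c)).trans (hx.sum_le_one v)

lemma sum_neighbors_le (hx : IsWeighting N x U D M K ρ) (hN : IsNearlyDisjointFamily N C D)
    (hρ : 0 ≤ ρ) {v : V} {c : α} (h : 0 < x v c) : ∑ u ∈ neighbors N v, x u c ≤ C * ρ :=
  hN.sum_neighbors_le (fun u => hx.nonneg u c) (fun i => hx.color_degree_le i v c h) hρ

/-- Once the color degrees are small, random colors drawn according to the weights work. -/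
theorem hasWeightedColoring_of_small [Nonempty α] (hx : IsWeighting N x U D M K ρ)
    (hN : IsNearlyDisjointFamily N C D) (hρ : 0 ≤ ρ) (hsmall : C * ρ ≤ 1 / 16) :
    HasWeightedColoring N x U := by
  let μ : U → α → ℝ := fun v c => x v c
  have hμ : IsProbWeight μ := ⟨fun v c => hx.nonneg v c, fun v => hx.sum_eq_one v v.2⟩
  let P : U → U → ℝ := fun a b => ∑ c, x a c * x b c
  have hPnn : ∀ a b, 0 ≤ P a b := fun a b =>
    sum_nonneg fun c _ => mul_nonneg (hx.nonneg _ _) (hx.nonneg _ _)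
  have hPsymm : ∀ a b, P a b = P b a := fun a b => sum_congr rfl fun c _ => mul_comm _ _
  let R : U → U → ℝ := fun a b => if (b : V) ∈ neighbors N a then P a b else 0
  have hRnn : ∀ a b, 0 ≤ R a b := fun a b => by
    simp only [R]
    split_ifs
    exacts [hPnn a b, le_rfl]
  have hRsymm : ∀ a b, R a b = R b a := fun a b => by
    have : (b : V) ∈ neighbors N a ↔ (a : V) ∈ neighbors N b :=
      ⟨hN.neighbors_symm, hN.neighbors_symm⟩
    simp only [R, this, hPsymm a b]
  have hRsum : ∀ a, ∑ b, R a b ≤ 1 / 16 := by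
    intro a
    have h1 : ∑ b, R a b ≤ ∑ b ∈ neighbors N a, ∑ c, x a c * x b c := by
      have : ∑ b : U, R a b = ∑ b ∈ univ.filter (fun b : U => (b : V) ∈ neighbors N a), P a b := by
        rw [sum_filter]
      have hmap := sum_map (univ.filter (fun b : U => (b : V) ∈ neighbors N a))
        (Function.Embedding.subtype _) (fun b => ∑ c, x a c * x b c)
      refine this.le.trans (hmap.symm.le.trans ?_)
      refine sum_le_sum_of_subset_of_nonneg ?_ fun b _ _ =>
        sum_nonneg fun c _ => mul_nonneg (hx.nonneg _ _) (hx.nonneg _ _)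
      intro b hb
      simp only [mem_map, mem_filter, mem_univ, true_and] at hb
      obtain ⟨b', hb', rfl⟩ := hb
      exact hb'
    refine (h1.trans ?_).trans hsmall
    rw [sum_comm]
    have h2 : ∀ c, ∑ b ∈ neighbors N a, x a c * x b c ≤ x a c * (C * ρ) := by
      intro c
      rw [← mul_sum]
      rcases (hx.nonneg a c).eq_or_lt with h | h
      · simp [← h]
      · exact mul_le_mul_of_nonneg_left (hx.sum_neighbors_le hN hρ h) h.le
    refine (sum_le_sum fun c _ => h2 c).trans ?_
    rw [← sum_mul, hx.sum_eq_one a a.2, one_mul]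
  let A : U × U → Set (U → α) := fun k => {ω | ω k.1 = ω k.2}
  let T : Finset (U × U) := univ.filter fun k => (k.2 : V) ∈ neighbors N k.1
  have hne : ∀ k ∈ T, k.1 ≠ k.2 := by
    rintro ⟨a, b⟩ hk h
    simp only [T, mem_filter, mem_univ, true_and] at hk h
    exact hN.notMem_neighbors a (by simpa [← h] using hk)
  have hprob : ∀ k ∈ T, prob μ (A k) = R k.1 k.2 := by
    intro k hk
    rw [prob_coordinates_eq hμ (hne k hk)]
    simp only [T, mem_filter, mem_univ, true_and] at hk
    simp only [R, if_pos hk, P, μ]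
  have hex := exists_avoiding_all hμ A (fun k => {k.1, k.2}) T ?_ ?_ ?_
  · obtain ⟨ω, hpos, hω⟩ := hex
    refine ⟨fun v => if hv : v ∈ U then ω ⟨v, hv⟩ else Classical.arbitrary α, ?_, ?_⟩
    · intro v hv
      simp only [hv, dif_pos]
      refine lt_of_le_of_ne (hx.nonneg _ _) fun h => hpos.ne' ?_
      exact prod_eq_zero (mem_univ (⟨v, hv⟩ : U)) h.symm
    · intro u hu v hv huv
      simp only [hu, hv, dif_pos]
      intro h
      exact hω (⟨v, hv⟩, ⟨u, hu⟩) (by simpa [T] using huv) h.symm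
  · intro k _ ω ω' h
    simp only [A, Set.mem_ofPred_eq]
    rw [h k.1 (by simp), h k.2 (by simp)]
  · intro k hk
    rw [hprob k hk]
    exact ((single_le_sum (fun b _ => hRnn k.1 b) (mem_univ k.2)).trans (hRsum _)).trans
      (by norm_num)
  · rintro ⟨a, b⟩ - T' hT' hdis
    -- An event sharing a vertex with `(a, b)` has `a` or `b` as its first or second entry; each of
    -- the four cases contributes at most `1/16`.
    have hmono : ∑ l ∈ T', prob μ (A l) ≤ ∑ l : U × U,
        ((if l.1 = a then R l.1 l.2 else 0) + (if l.1 = b then R l.1 l.2 else 0)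
          + (if l.2 = a then R l.1 l.2 else 0) + (if l.2 = b then R l.1 l.2 else 0)) := by
      have hnn : ∀ l : U × U, 0 ≤
        ((if l.1 = a then R l.1 l.2 else 0) + (if l.1 = b then R l.1 l.2 else 0)
          + (if l.2 = a then R l.1 l.2 else 0) + (if l.2 = b then R l.1 l.2 else 0)) := by
        intro l
        have := hRnn l.1 l.2
        split_ifs <;> linarith
      refine le_trans (sum_le_sum fun l hl => ?_)
        (sum_le_sum_of_subset_of_nonneg (subset_univ T') fun l _ _ => hnn l)
      rw [hprob l (hT' hl)]
      have hmeet := hdis l hl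
      have := hRnn l.1 l.2
      have hor : l.1 = a ∨ l.1 = b ∨ l.2 = a ∨ l.2 = b := by
        rw [Set.not_disjoint_iff] at hmeet
        obtain ⟨z, hz1, hz2⟩ := hmeet
        simp only [Set.mem_insert_iff, Set.mem_singleton_iff] at hz1 hz2
        rcases hz1 with rfl | rfl <;> rcases hz2 with rfl | rfl <;> simp
      rcases hor with h | h | h | h <;> rw [if_pos h] <;> split_ifs <;> linarith
    refine hmono.trans ?_
    simp only [sum_add_distrib, Fintype.sum_prod_type]
    have e1 : ∀ z : U, ∑ y : U, ∑ y' : U, (if y = z then R y y' else 0) = ∑ y', R z y' := by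
      intro z
      rw [sum_comm]
      exact sum_congr rfl fun y' _ => by simp
    have e2 : ∀ z : U, ∑ y : U, ∑ y' : U, (if y' = z then R y y' else 0) = ∑ y', R z y' := by
      intro z
      refine sum_congr rfl fun y _ => ?_
      simp [hRsymm y z]
    rw [e1, e1, e2, e2]
    linarith [hRsum a, hRsum b]

end IsWeighting

end NibbleColoring

/-! ### Tail bounds for weighted counts of unblocked items and of conflicts. -/

namespace ProductExpectation

open Function Finset

variable {I κ : Type*} [Fintype I] [DecidableEq I]

lemma abs_sum_none_sub_le {s : Finset κ} {a : κ → ℝ} (ha : ∀ k ∈ s, 0 ≤ a k) (F : κ → Finset I)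
    (ω : I → Bool) (i : I) :
    |∑ k ∈ s, a k * (if ∀ e ∈ F k, update ω i true e = false then 1 else 0)
      - ∑ k ∈ s, a k * (if ∀ e ∈ F k, update ω i false e = false then 1 else 0)|
      ≤ ∑ k ∈ s with i ∈ F k, a k := by
  rw [← sum_sub_distrib, sum_filter]
  refine (abs_sum_le_sum_abs _ _).trans (sum_le_sum fun k hk => ?_)
  by_cases hi : i ∈ F k
  · rw [if_pos hi, ← mul_sub, abs_mul, abs_of_nonneg (ha k hk)]
    refine mul_le_of_le_one_right (ha k hk) ?_
    split_ifs <;> simp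
  · have : (∀ e ∈ F k, update ω i true e = false) ↔ (∀ e ∈ F k, update ω i false e = false) := by
      refine forall₂_congr fun e he => ?_
      have hne : e ≠ i := fun h => hi (h ▸ he)
      rw [update_of_ne hne, update_of_ne hne]
    simp only [if_neg hi, this, sub_self, abs_zero, le_refl]

lemma expect_sum_none (q : I → ℝ) (s : Finset κ) (a : κ → ℝ) (F : κ → Finset I) :
    expect (bits q) (fun ω => ∑ k ∈ s, a k * (if ∀ e ∈ F k, ω e = false then 1 else 0))
      = ∑ k ∈ s, a k * ∏ e ∈ F k, (1 - q e) := by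
  rw [expect_sum]
  refine sum_congr rfl fun k _ => ?_
  rw [expect_const_mul, expect_bits_none]

/-- One factor of the square is bounded by `B`; the remaining sum is `v` after double counting the
pairs `e ∈ F k`. -/
lemma sum_mul_sq_le {q : I → ℝ} (h0 : ∀ i, 0 ≤ q i) {s : Finset κ} {a : κ → ℝ}
    (ha : ∀ k ∈ s, 0 ≤ a k) (F : κ → Finset I) {B v : ℝ}
    (hB : ∀ e, ∑ k ∈ s with e ∈ F k, a k ≤ B) (hB0 : 0 ≤ B)
    (hv : ∑ k ∈ s, a k * ∑ e ∈ F k, q e ≤ v) :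
    ∑ e, q e * (∑ k ∈ s with e ∈ F k, a k) ^ 2 ≤ B * v := by
  have h1 : ∑ e, q e * (∑ k ∈ s with e ∈ F k, a k) ^ 2
      ≤ ∑ e, B * (q e * ∑ k ∈ s with e ∈ F k, a k) := by
    refine sum_le_sum fun e _ => ?_
    have hnn : 0 ≤ ∑ k ∈ s with e ∈ F k, a k :=
      sum_nonneg fun k hk => ha k (filter_subset _ _ hk)
    have := mul_le_mul_of_nonneg_left (hB e) (mul_nonneg (h0 e) hnn)
    linarith
  refine h1.trans ?_
  rw [← mul_sum]
  refine mul_le_mul_of_nonneg_left (le_trans (le_of_eq ?_) hv) hB0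
  simp only [sum_filter, mul_sum]
  rw [sum_comm]
  refine sum_congr rfl fun k _ => ?_
  simp only [mul_ite, mul_zero, sum_ite_mem, univ_inter]
  exact sum_congr rfl fun i _ => mul_comm _ _

/-- Upper tail of a weighted number of sets of bits without any success. -/
theorem prob_le_sum_none {q : I → ℝ} (h0 : ∀ i, 0 ≤ q i) (h1 : ∀ i, q i ≤ 1) {s : Finset κ}
    {a : κ → ℝ} (ha : ∀ k ∈ s, 0 ≤ a k) (F : κ → Finset I) {B v r m : ℝ}
    (hB : ∀ e, ∑ k ∈ s with e ∈ F k, a k ≤ B) (hB0 : 0 ≤ B)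
    (hv : ∑ k ∈ s, a k * ∑ e ∈ F k, q e ≤ v) (hr : 0 ≤ r) (hrB : r * B ≤ 1)
    (hm : ∑ k ∈ s, a k * ∏ e ∈ F k, (1 - q e) ≤ m) (t : ℝ) :
    prob (bits q) {ω | m + t ≤ ∑ k ∈ s, a k * (if ∀ e ∈ F k, ω e = false then 1 else 0)}
      ≤ Real.exp (r ^ 2 * (B * v) - r * t) := by
  refine le_trans (prob_mono (isProbWeight_bits h0 h1) ?_)
    (prob_expect_add_le
      (f := fun ω => ∑ k ∈ s, a k * (if ∀ e ∈ F k, ω e = false then 1 else 0)) h0 h1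
      (abs_sum_none_sub_le ha F) hr
      (fun e => (mul_le_mul_of_nonneg_left (hB e) hr).trans hrB)
      (sum_mul_sq_le h0 ha F hB hB0 hv) t)
  intro ω hω
  rw [Set.mem_ofPred_eq] at *
  rw [expect_sum_none]
  linarith

/-- Lower tail of a weighted number of sets of bits without any success. -/
theorem prob_sum_none_le {q : I → ℝ} (h0 : ∀ i, 0 ≤ q i) (h1 : ∀ i, q i ≤ 1) {s : Finset κ}
    {a : κ → ℝ} (ha : ∀ k ∈ s, 0 ≤ a k) (F : κ → Finset I) {B v r m : ℝ}
    (hB : ∀ e, ∑ k ∈ s with e ∈ F k, a k ≤ B) (hB0 : 0 ≤ B)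
    (hv : ∑ k ∈ s, a k * ∑ e ∈ F k, q e ≤ v) (hr : 0 ≤ r) (hrB : r * B ≤ 1)
    (hm : m ≤ ∑ k ∈ s, a k * ∏ e ∈ F k, (1 - q e)) (t : ℝ) :
    prob (bits q) {ω | ∑ k ∈ s, a k * (if ∀ e ∈ F k, ω e = false then 1 else 0) ≤ m - t}
      ≤ Real.exp (r ^ 2 * (B * v) - r * t) := by
  refine le_trans (prob_mono (isProbWeight_bits h0 h1) ?_)
    (prob_expect_add_le
      (f := fun ω => -∑ k ∈ s, a k * (if ∀ e ∈ F k, ω e = false then 1 else 0)) h0 h1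
      (fun ω i => ?_) hr
      (fun e => (mul_le_mul_of_nonneg_left (hB e) hr).trans hrB)
      (sum_mul_sq_le h0 ha F hB hB0 hv) t)
  · intro ω hω
    rw [Set.mem_ofPred_eq] at *
    have := expect_const_mul (μ := bits q) (-1)
      (fun ω => ∑ k ∈ s, a k * (if ∀ e ∈ F k, ω e = false then 1 else 0))
    rw [expect_sum_none] at this
    simp only [neg_one_mul] at this
    rw [this]
    linarith
  · rw [neg_sub_neg, abs_sub_comm]
    exact abs_sum_none_sub_le ha F ω i

/-- The integrand factors over the bits. The bits `u` and `w` give at most `q u * q w * e^{1/2}`,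
the other bits at most `e^{1/2}`, and `e < 3`. -/
lemma expect_two_successes_le {q b : I → ℝ} (h0 : ∀ i, 0 ≤ q i) (h1 : ∀ i, q i ≤ 1)
    (s : Finset I) (hb0 : ∀ i, 0 ≤ b i) (hb : ∀ i, b i ≤ 1 / 4)
    (hsum : ∑ i ∈ s, 2 * (q i * b i) ≤ 1 / 2) {u w : I} (huw : u ≠ w) :
    expect (bits q) (fun ω => if ω u = true ∧ ω w = true then
      Real.exp (∑ i ∈ s, if ω i = true then b i else 0) else 0) ≤ 3 * (q u * q w) := by
  have hprod : (fun ω : I → Bool => if ω u = true ∧ ω w = true then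
      Real.exp (∑ i ∈ s, if ω i = true then b i else 0) else 0)
      = fun ω => ∏ i, ((if (i = u ∨ i = w) ∧ ω i = false then 0 else 1)
        * (if i ∈ s ∧ ω i = true then Real.exp (b i) else 1)) := by
    funext ω
    rw [prod_mul_distrib]
    have e1 : ∏ i, (if i ∈ s ∧ ω i = true then Real.exp (b i) else 1)
        = Real.exp (∑ i ∈ s, if ω i = true then b i else 0) := by
      rw [Real.exp_sum, ← prod_subset (subset_univ s)]
      · refine prod_congr rfl fun i hi => ?_
        by_cases h : ω i = true <;> simp [hi, h]
      · intro i _ hi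
        simp [hi]
    rw [e1]
    by_cases h : ω u = true ∧ ω w = true
    · rw [if_pos h, prod_eq_one, one_mul]
      intro i _
      rw [if_neg]
      rintro ⟨rfl | rfl, hi⟩
      · simp [h.1] at hi
      · simp [h.2] at hi
    · rw [if_neg h]
      rw [not_and_or] at h
      rcases h with h | h
      · rw [prod_eq_zero (mem_univ u), zero_mul]
        simp [h]
      · rw [prod_eq_zero (mem_univ w), zero_mul]
        simp [h]
  rw [hprod, expect_bits_prod q (fun i y => (if (i = u ∨ i = w) ∧ y = false then 0 else 1)
        * (if i ∈ s ∧ y = true then Real.exp (b i) else 1))]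
  have hexpb : ∀ i, Real.exp (b i) ≤ Real.exp (1 / 4) := fun i => Real.exp_le_exp.mpr (hb i)
  have hq14 : (1 : ℝ) ≤ Real.exp (1 / 4) := Real.one_le_exp (by norm_num)
  have hite : ∀ i, (if i ∈ s then Real.exp (b i) else 1) ≤ Real.exp (1 / 4) := fun i => by
    split_ifs
    exacts [hexpb i, hq14]
  have hone : ∀ i, 1 ≤ Real.exp (if i ∈ s then 2 * (q i * b i) else 0) := fun i => by
    refine Real.one_le_exp ?_
    have := mul_nonneg (h0 i) (hb0 i)
    split_ifs <;> linarith
  calc _ ≤ ∏ i, ((if i = u then q u * Real.exp (1 / 4) else 1)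
        * (if i = w then q w * Real.exp (1 / 4) else 1)
        * Real.exp (if i ∈ s then 2 * (q i * b i) else 0)) := by
        refine prod_le_prod (fun i _ => ?_) fun i _ => ?_
        · have := h0 i
          have := h1 i
          have : 0 ≤ 1 - q i := by linarith
          positivity
        · by_cases hiu : i = u
          · subst hiu
            simp only [true_or, true_and, and_true, if_true, huw, if_false]
            have := mul_le_mul_of_nonneg_left (hite i) (h0 i)
            have h2 := mul_le_mul_of_nonneg_left (hone i)
              (mul_nonneg (h0 i) (Real.exp_pos (1 / 4)).le)
            simp only [Bool.true_eq_false, if_false, one_mul, zero_mul, mul_zero, add_zero,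
              mul_one] at *
            linarith
          · by_cases hiw : i = w
            · subst hiw
              simp only [or_true, true_and, and_true, if_true, hiu, if_false]
              have := mul_le_mul_of_nonneg_left (hite i) (h0 i)
              have h2 := mul_le_mul_of_nonneg_left (hone i)
                (mul_nonneg (h0 i) (Real.exp_pos (1 / 4)).le)
              simp only [Bool.true_eq_false, if_false, one_mul, zero_mul, mul_zero, add_zero,
                mul_one] at *
              linarith
            · simp only [hiu, hiw, or_self, false_and, if_false, one_mul, and_true,
                Bool.false_eq_true, and_false, mul_one]
              by_cases his : i ∈ s
              · simp only [his, if_true]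
                have hx := (abs_le.mp (Real.abs_exp_sub_one_sub_id_le
                  (x := b i) (by rw [abs_of_nonneg (hb0 i)]; linarith [hb i]))).2
                have h2 := Real.add_one_le_exp (2 * (q i * b i))
                have h3 : Real.exp (b i) ≤ 1 + 2 * b i := by nlinarith [hb0 i, hb i]
                have := mul_le_mul_of_nonneg_left h3 (h0 i)
                linarith
              · simp [his]
    _ = q u * q w * (Real.exp (1 / 4) * Real.exp (1 / 4)
          * Real.exp (∑ i ∈ s, 2 * (q i * b i))) := by
        rw [prod_mul_distrib, prod_mul_distrib, ← Real.exp_sum]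
        simp only [prod_ite_eq', mem_univ, if_true, sum_ite_mem, univ_inter]
        ring
    _ ≤ q u * q w * 3 := by
        refine mul_le_mul_of_nonneg_left ?_ (mul_nonneg (h0 u) (h0 w))
        rw [← Real.exp_add, ← Real.exp_add]
        have hle : 1 / 4 + 1 / 4 + ∑ i ∈ s, 2 * (q i * b i) ≤ 1 := by linarith
        exact (Real.exp_le_exp.mpr hle).trans Real.exp_one_lt_three.le
    _ = _ := by ring

/-- A bit `u` is in conflict if both `u` and some bit in `R u` succeed. The weighted number of
conflicts has a moment generating function as small as its expectation suggests. -/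
theorem expect_exp_conflicts_le {q b : I → ℝ} (h0 : ∀ i, 0 ≤ q i) (h1 : ∀ i, q i ≤ 1)
    (s : Finset I) (R : I → Finset I) (hR : ∀ u, u ∉ R u) (hb0 : ∀ i, 0 ≤ b i)
    (hb : ∀ i, b i ≤ 1 / 4) (hsum : ∑ i ∈ s, 2 * (q i * b i) ≤ 1 / 2) :
    expect (bits q) (fun ω => Real.exp (∑ u ∈ s,
      b u * if ω u = true ∧ ∃ w ∈ R u, ω w = true then 1 else 0))
      ≤ Real.exp (3 * ∑ u ∈ s, b u * (q u * ∑ w ∈ R u, q w)) := by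
  have hμ := isProbWeight_bits h0 h1
  have hpt : ∀ ω : I → Bool, Real.exp (∑ u ∈ s,
      b u * if ω u = true ∧ ∃ w ∈ R u, ω w = true then 1 else 0)
      ≤ 1 + ∑ u ∈ s, b u * ∑ w ∈ R u, (if ω u = true ∧ ω w = true then
        Real.exp (∑ i ∈ s, if ω i = true then b i else 0) else 0) := by
    intro ω
    set Y := ∑ u ∈ s, b u * if ω u = true ∧ ∃ w ∈ R u, ω w = true then (1 : ℝ) else 0 with hY
    -- This reduces the moment to `E (Y e^Y)`. There `Y` is split into pairs of successes, while the
    -- `Y` in the exponent is replaced by the weight of all successes in `s`, so that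
    -- `expect_two_successes_le` applies.
    have hexp : Real.exp Y ≤ 1 + Y * Real.exp Y := by
      have h2 := mul_le_mul_of_nonneg_right (Real.one_sub_le_exp_neg Y) (Real.exp_pos Y).le
      rw [← Real.exp_add, neg_add_cancel, Real.exp_zero] at h2
      linarith
    refine hexp.trans (add_le_add le_rfl ?_)
    have hYle : Y ≤ ∑ i ∈ s, if ω i = true then b i else 0 := by
      refine sum_le_sum fun u _ => ?_
      by_cases hu : ω u = true
      · rw [if_pos hu]
        refine mul_le_of_le_one_right (hb0 u) ?_
        split_ifs <;> simp
      · simp [hu]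
    rw [hY, sum_mul]
    refine sum_le_sum fun u _ => ?_
    rw [mul_assoc]
    refine mul_le_mul_of_nonneg_left ?_ (hb0 u)
    rw [← hY]
    have hnn : ∀ w ∈ R u, (0 : ℝ) ≤ (if ω u = true ∧ ω w = true then
        Real.exp (∑ i ∈ s, if ω i = true then b i else 0) else 0) := by
      intro w _
      positivity
    by_cases h : ω u = true ∧ ∃ w ∈ R u, ω w = true
    · obtain ⟨w, hw, hw'⟩ := h.2
      rw [if_pos h, one_mul]
      refine le_trans ?_ (single_le_sum hnn hw)
      rw [if_pos ⟨h.1, hw'⟩]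
      exact Real.exp_le_exp.mpr hYle
    · rw [if_neg h, zero_mul]
      exact sum_nonneg hnn
  refine (expect_mono hμ hpt).trans ?_
  rw [expect_add, expect_const hμ, expect_sum]
  have h2 : ∀ u ∈ s, expect (bits q) (fun ω => b u * ∑ w ∈ R u,
      (if ω u = true ∧ ω w = true then
        Real.exp (∑ i ∈ s, if ω i = true then b i else 0) else 0))
      ≤ 3 * (b u * (q u * ∑ w ∈ R u, q w)) := by
    intro u _
    rw [expect_const_mul, expect_sum]
    have : ∑ w ∈ R u, expect (bits q) (fun ω => if ω u = true ∧ ω w = true then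
        Real.exp (∑ i ∈ s, if ω i = true then b i else 0) else 0)
        ≤ ∑ w ∈ R u, 3 * (q u * q w) :=
      sum_le_sum fun w hw => expect_two_successes_le h0 h1 s hb0 hb hsum
        fun h => hR u (h ▸ hw)
    rw [← mul_sum, ← mul_sum] at this
    have := mul_le_mul_of_nonneg_left this (hb0 u)
    linarith
  have h3 := sum_le_sum h2
  rw [← mul_sum] at h3
  linarith [Real.add_one_le_exp (3 * ∑ u ∈ s, b u * (q u * ∑ w ∈ R u, q w))]

end ProductExpectation

/-! ### One round: expectation and concentration of the relevant weights. -/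

namespace NibbleColoring

open Finset ProductExpectation

variable {V ι α : Type*} [Fintype V] [DecidableEq V] [Fintype ι] [DecidableEq ι]
  [Fintype α] [DecidableEq α]

lemma one_sub_sum_le_prod_one_sub {κ : Type*} (s : Finset κ) {f : κ → ℝ} (h0 : ∀ k ∈ s, 0 ≤ f k)
    (h1 : ∀ k ∈ s, f k ≤ 1) : 1 - ∑ k ∈ s, f k ≤ ∏ k ∈ s, (1 - f k) := by
  classical
  induction s using Finset.induction_on with
  | empty => simp
  | insert a s ha ih =>
    rw [sum_insert ha, prod_insert ha]
    have hih := ih (fun k hk => h0 k (mem_insert_of_mem hk)) fun k hk => h1 k (mem_insert_of_mem hk)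
    have ha0 := h0 a (mem_insert_self _ _)
    have ha1 := h1 a (mem_insert_self _ _)
    have hs : 0 ≤ ∑ k ∈ s, f k := sum_nonneg fun k hk => h0 k (mem_insert_of_mem hk)
    have := mul_le_mul_of_nonneg_left hih (by linarith : 0 ≤ 1 - f a)
    nlinarith

/-- The standing assumptions for one round of the random coloring procedure with rate `p`. -/
structure IsRound (N : ι → V → Finset V) (x : V → α → ℝ) (U : Finset V) (C : ℕ)
    (D M K ρ p : ℝ) : Prop where
  family : IsNearlyDisjointFamily N C D
  weighting : IsWeighting N x U D M K ρ
  one_le_C : 1 ≤ C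
  one_le_D : 1 ≤ D
  one_le_K : 1 ≤ K
  ρ_nonneg : 0 ≤ ρ
  ρ_le_one : ρ ≤ 1
  p_nonneg : 0 ≤ p
  p_le_one : p ≤ 1
  rate_le : p * (C * ρ) ≤ 1 / 2

/-- The bit `(v, c)` succeeds when the color `c` is proposed for `v`. -/
def rate (x : V → α → ℝ) (p : ℝ) : V × α → ℝ := fun e => p * x e.1 e.2

/-- The probability that no neighbor of `v` is proposed the color `c`. -/
def keep (N : ι → V → Finset V) (x : V → α → ℝ) (p : ℝ) (v : V) (c : α) : ℝ :=
  ∏ w ∈ neighbors N v, (1 - p * x w c)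

/-- The weight of `c` at `v` after a round in which `c` survives at `v`. -/
noncomputable def boosted (N : ι → V → Finset V) (x : V → α → ℝ) (p : ℝ) (v : V) (c : α) : ℝ :=
  x v c / keep N x p v c

/-- The proposals that remove `c` from `v`. -/
def blockers (N : ι → V → Finset V) (v : V) (c : α) : Finset (V × α) :=
  neighbors N v ×ˢ {c}

/-- The total weight surviving at `v`. -/
noncomputable def survivingWeight (N : ι → V → Finset V) (x : V → α → ℝ) (p : ℝ)
    (ω : V × α → Bool) (v : V) : ℝ :=
  ∑ c, boosted N x p v c * (if ∀ e ∈ blockers N v c, ω e = false then 1 else 0)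

/-- The proposals at `u` of colors other than `c`, and those that remove `c` from `u` by an edge
outside of the `i`-th graph. -/
def outerBlockers (N : ι → V → Finset V) (i : ι) (c : α) (u : V) : Finset (V × α) :=
  ({u} ×ˢ univ.erase c) ∪ ((neighbors N u \ N i u) ×ˢ {c})

/-- The weight of `c` on the neighbors of `v` in the `i`-th graph that get no other proposal and
where `c` is not removed by an edge outside of this graph. -/
noncomputable def idleWeight (N : ι → V → Finset V) (x : V → α → ℝ) (p : ℝ)
    (ω : V × α → Bool) (i : ι) (v : V) (c : α) : ℝ :=
  ∑ u ∈ N i v, boosted N x p u c * (if ∀ e ∈ outerBlockers N i c u, ω e = false then 1 else 0)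

/-- The weight of `c` on the neighbors of `v` in the `i`-th graph with a proposed color that is also
proposed at one of their neighbors. -/
noncomputable def conflictWeight (N : ι → V → Finset V) (x : V → α → ℝ) (p : ℝ)
    (ω : V × α → Bool) (i : ι) (v : V) (c : α) : ℝ :=
  ∑ u ∈ N i v, boosted N x p u c *
    (if ∃ d, ω (u, d) = true ∧ ∃ w ∈ neighbors N u, ω (w, d) = true then 1 else 0)

variable {N : ι → V → Finset V} {x : V → α → ℝ} {U : Finset V} {C : ℕ} {D M K ρ p : ℝ}

set_option linter.unusedSectionVars false

namespace IsRound

lemma rate_nonneg (h : IsRound N x U C D M K ρ p) (e : V × α) : 0 ≤ rate x p e :=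
  mul_nonneg h.p_nonneg (h.weighting.nonneg _ _)

lemma mul_le_one (h : IsRound N x U C D M K ρ p) (v : V) (c : α) : p * x v c ≤ 1 :=
  mul_le_one₀ h.p_le_one (h.weighting.nonneg _ _) (h.weighting.le_one _ _)

lemma rate_le_one (h : IsRound N x U C D M K ρ p) (e : V × α) : rate x p e ≤ 1 :=
  h.mul_le_one _ _

lemma sum_neighbors_le (h : IsRound N x U C D M K ρ p) {v : V} {c : α} (hv : 0 < x v c) :
    ∑ w ∈ neighbors N v, p * x w c ≤ 1 / 2 := by
  rw [← mul_sum]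
  exact (mul_le_mul_of_nonneg_left (h.weighting.sum_neighbors_le h.family h.ρ_nonneg hv)
    h.p_nonneg).trans h.rate_le

lemma half_le_keep (h : IsRound N x U C D M K ρ p) {v : V} {c : α} (hv : 0 < x v c) :
    1 / 2 ≤ keep N x p v c := by
  refine le_trans ?_ (one_sub_sum_le_prod_one_sub _
    (fun w _ => mul_nonneg h.p_nonneg (h.weighting.nonneg w c)) fun w _ => h.mul_le_one w c)
  linarith [h.sum_neighbors_le hv]

lemma keep_nonneg (h : IsRound N x U C D M K ρ p) (v : V) (c : α) : 0 ≤ keep N x p v c :=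
  prod_nonneg fun w _ => by linarith [h.mul_le_one w c]

lemma boosted_nonneg (h : IsRound N x U C D M K ρ p) (v : V) (c : α) : 0 ≤ boosted N x p v c :=
  div_nonneg (h.weighting.nonneg v c) (h.keep_nonneg v c)

lemma boosted_eq_zero {v : V} {c : α} (hv : x v c = 0) : boosted N x p v c = 0 := by
  rw [boosted, hv, zero_div]

lemma boosted_le (h : IsRound N x U C D M K ρ p) (v : V) (c : α) :
    boosted N x p v c ≤ 2 * x v c := by
  rcases (h.weighting.nonneg v c).eq_or_lt with h0 | h0
  · rw [boosted_eq_zero h0.symm, ← h0, mul_zero]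
  · have := h.half_le_keep h0
    rw [boosted, div_le_iff₀ (by linarith)]
    nlinarith

lemma boosted_le_div (h : IsRound N x U C D M K ρ p) (v : V) (c : α) :
    boosted N x p v c ≤ 2 * K / D := by
  have h1 := h.boosted_le v c
  have h2 := h.weighting.le_div v c
  rw [mul_div_assoc]
  linarith

lemma div_le_mul (h : IsRound N x U C D M K ρ p) : 2 * K / D ≤ C * (2 * K / D) := by
  have h1 : (1 : ℝ) ≤ C := by exact_mod_cast h.one_le_C
  have h2 : 0 ≤ 2 * K / D := by
    have := h.one_le_K
    have := h.one_le_D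
    positivity
  nlinarith

/-- The rate `δD/(12CK)` minimizes `r²Bv - rδ` for `B = 2CK/D` and `v = 3`. The exponent is weakened
from `K` to `K²` so that the conflict bound can share it. -/
lemma exp_tail_le (h : IsRound N x U C D M K ρ p) (δ : ℝ) :
    Real.exp ((δ * D / (12 * C * K)) ^ 2 * (C * (2 * K / D) * 3) - δ * D / (12 * C * K) * δ)
      ≤ Real.exp (-(δ ^ 2 / (24 * C * K ^ 2) * D)) := by
  have h1 : (1 : ℝ) ≤ C := by exact_mod_cast h.one_le_C
  have h2 := h.one_le_K
  have h3 := h.one_le_D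
  have e : (δ * D / (12 * C * K)) ^ 2 * (C * (2 * K / D) * 3) - δ * D / (12 * C * K) * δ
      = -(δ ^ 2 / (24 * C * K) * D) := by
    field_simp
    ring
  rw [e, Real.exp_le_exp, neg_le_neg_iff]
  have : K ≤ K ^ 2 := by nlinarith
  gcongr

lemma tail_rate_le (h : IsRound N x U C D M K ρ p) {δ : ℝ} (hδ1 : δ ≤ 1) :
    δ * D / (12 * C * K) * (C * (2 * K / D)) ≤ 1 := by
  have h1 : (1 : ℝ) ≤ C := by exact_mod_cast h.one_le_C
  have h2 := h.one_le_K
  have h3 := h.one_le_D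
  have e : δ * D / (12 * C * K) * (C * (2 * K / D)) = δ / 6 := by
    field_simp
    ring
  rw [e]
  linarith

lemma tail_rate_nonneg (h : IsRound N x U C D M K ρ p) {δ : ℝ} (hδ : 0 ≤ δ) :
    0 ≤ δ * D / (12 * C * K) := by
  have h2 := h.one_le_K
  have h3 := h.one_le_D
  positivity

lemma bound_nonneg (h : IsRound N x U C D M K ρ p) : 0 ≤ (C : ℝ) * (2 * K / D) := by
  have h2 := h.one_le_K
  have h3 := h.one_le_D
  positivity

/-- The boost cancels the survival probability, so the mean is 1. A proposal influences only the
term of its own color, which is at most `2K/D`. -/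
theorem prob_survivingWeight_le (h : IsRound N x U C D M K ρ p) {δ : ℝ} (hδ : 0 ≤ δ)
    (hδ1 : δ ≤ 1) {v : V} (hv : v ∈ U) :
    prob (bits (rate x p)) {ω | survivingWeight N x p ω v ≤ 1 - δ}
      ≤ Real.exp (-(δ ^ 2 / (24 * C * K ^ 2) * D)) := by
  refine (prob_sum_none_le h.rate_nonneg h.rate_le_one (fun c _ => h.boosted_nonneg v c)
    (blockers N v) (B := C * (2 * K / D)) (v := 3) ?_ h.bound_nonneg ?_
    (h.tail_rate_nonneg hδ) (h.tail_rate_le hδ1) ?_ δ).trans (h.exp_tail_le δ)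
  · intro e
    have hsub : (univ.filter fun c => e ∈ blockers N v c) ⊆ {e.2} := by
      intro c hc
      simp only [blockers, mem_filter, mem_univ, true_and, mem_product, mem_singleton] at hc
      simp [hc.2]
    refine (sum_le_sum_of_subset_of_nonneg hsub fun c _ _ => h.boosted_nonneg v c).trans ?_
    rw [sum_singleton]
    exact (h.boosted_le_div v e.2).trans h.div_le_mul
  · have : ∀ c ∈ univ, boosted N x p v c * ∑ e ∈ blockers N v c, rate x p e ≤ x v c := by
      intro c _
      rw [blockers, sum_product]
      simp only [sum_singleton, rate]
      rcases (h.weighting.nonneg v c).eq_or_lt with h0 | h0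
      · rw [boosted_eq_zero h0.symm, ← h0, zero_mul]
      · have h1 := mul_le_mul (h.boosted_le v c) (h.sum_neighbors_le h0)
          (sum_nonneg fun w _ => mul_nonneg h.p_nonneg (h.weighting.nonneg w c))
          (by linarith)
        linarith
    linarith [sum_le_sum this, h.weighting.sum_le_one v]
  · refine (h.weighting.sum_eq_one v hv).ge.trans (sum_le_sum fun c _ => ?_)
    rw [blockers, prod_product]
    simp only [prod_singleton, rate]
    rcases (h.weighting.nonneg v c).eq_or_lt with h0 | h0
    · rw [boosted_eq_zero h0.symm, ← h0, zero_mul]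
    · have := h.half_le_keep h0
      change x v c ≤ x v c / keep N x p v c * keep N x p v c
      rw [div_mul_cancel₀]
      linarith

/-- This is where near disjointness enters. If `(w, c)` removes `c` from `u` outside `G_i`, then `w`
and `u` are adjacent in some `G_j` with `j ≠ i`. There are at most `C` choices of `j`, and `u` is
determined by `j` as the only common vertex of `G_i` and `G_j`. A proposal of another color concerns
only its own vertex. -/
lemma card_outerBlockers_le (h : IsRound N x U C D M K ρ p) (i : ι) (v : V) (c : α) (e : V × α) :
    ((N i v).filter fun u => e ∈ outerBlockers N i c u).card ≤ C := by
  have : Nonempty ι := ⟨i⟩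
  obtain ⟨w, d⟩ := e
  by_cases hd : d = c
  · subst hd
    have hex : ∀ u ∈ (N i v).filter fun u => (w, d) ∈ outerBlockers N i d u,
        ∃ j, j ≠ i ∧ w ∈ N j u := by
      intro u hu
      simp only [outerBlockers, mem_filter, mem_union, mem_product, mem_singleton, mem_erase, ne_eq,
        not_true_eq_false, false_and, and_false, false_or, mem_sdiff, mem_neighbors,
        and_true] at hu
      obtain ⟨-, ⟨j, hj⟩, hi⟩ := hu
      exact ⟨j, fun hji => hi (hji ▸ hj), hj⟩
    choose! J hJ1 hJ2 using hex
    refine le_trans (card_le_card_of_injOn J ?_ ?_) (h.family.index_le w)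
    · intro u hu
      simp only [coe_filter, mem_univ, true_and, Set.mem_ofPred_eq]
      exact ⟨u, h.family.symm (hJ2 u hu)⟩
    · intro u hu u' hu' huu'
      have hv : ∀ u ∈ (N i v).filter fun u => (w, d) ∈ outerBlockers N i d u,
          (N i u).Nonempty := fun u hu => ⟨v, h.family.symm (mem_filter.mp hu).1⟩
      refine h.family.eq_of_shared (hJ1 u hu).symm (hv u hu) ⟨w, hJ2 u hu⟩ (hv u' hu') ?_
      rw [huu']
      exact ⟨w, hJ2 u' hu'⟩
  · refine le_trans ?_ h.one_le_C
    rw [card_le_one]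
    intro u hu u' hu'
    simp only [outerBlockers, mem_filter, mem_union, mem_product, mem_singleton, hd, and_false,
      or_false] at hu hu'
    rw [← hu.2.1, ← hu'.2.1]

lemma disjoint_outerBlockers (i : ι) (c : α) (u : V) :
    Disjoint (({u} : Finset V) ×ˢ univ.erase c) ((neighbors N u \ N i u) ×ˢ {c}) := by
  rw [disjoint_left]
  rintro ⟨w, d⟩ h1 h2
  simp only [mem_product, mem_erase, mem_singleton] at h1 h2
  exact h1.2.1 h2.2

theorem prob_le_idleWeight (h : IsRound N x U C D M K ρ p) {δ : ℝ} (hδ : 0 ≤ δ)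
    (hδ1 : δ ≤ 1) (i : ι) {v : V} {c : α} (hv : 0 < x v c) :
    prob (bits (rate x p))
      {ω | ρ * (Real.exp (-p + p * (K / D)) / (1 - p * ρ)) + δ ≤ idleWeight N x p ω i v c}
      ≤ Real.exp (-(δ ^ 2 / (24 * C * K ^ 2) * D)) := by
  have hC : (1 : ℝ) ≤ C := by exact_mod_cast h.one_le_C
  have hpρ : p * ρ ≤ 1 / 2 := by
    refine le_trans ?_ h.rate_le
    have := mul_nonneg h.p_nonneg h.ρ_nonneg
    nlinarith
  have hdeg := h.weighting.color_degree_le i v c hv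
  refine (prob_le_sum_none h.rate_nonneg h.rate_le_one (fun u _ => h.boosted_nonneg u c)
    (outerBlockers N i c) (B := C * (2 * K / D)) (v := 3) ?_ h.bound_nonneg ?_
    (h.tail_rate_nonneg hδ) (h.tail_rate_le hδ1) ?_ δ).trans (h.exp_tail_le δ)
  · intro e
    refine (sum_le_card_nsmul _ _ (2 * K / D) fun u _ => h.boosted_le_div u c).trans ?_
    rw [nsmul_eq_mul]
    have h1 : (((N i v).filter fun u => e ∈ outerBlockers N i c u).card : ℝ) ≤ C := by
      exact_mod_cast h.card_outerBlockers_le i v c e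
    have := h.one_le_K
    have := h.one_le_D
    gcongr
  · have : ∀ u ∈ N i v, boosted N x p u c * ∑ e ∈ outerBlockers N i c u, rate x p e
        ≤ 3 * x u c := by
      intro u _
      rw [outerBlockers, sum_union (disjoint_outerBlockers i c u), sum_product, sum_product]
      simp only [sum_singleton, rate]
      rcases (h.weighting.nonneg u c).eq_or_lt with h0 | h0
      · rw [boosted_eq_zero h0.symm, ← h0, zero_mul, mul_zero]
      · have h1 : ∑ d ∈ univ.erase c, p * x u d ≤ 1 := by
          rw [← mul_sum]
          refine mul_le_one₀ h.p_le_one (sum_nonneg fun d _ => h.weighting.nonneg u d) ?_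
          exact (sum_le_sum_of_subset_of_nonneg (erase_subset _ _) fun d _ _ =>
            h.weighting.nonneg u d).trans (h.weighting.sum_le_one u)
        have h2 : ∑ w ∈ neighbors N u \ N i u, p * x w c ≤ 1 / 2 :=
          (sum_le_sum_of_subset_of_nonneg sdiff_subset fun w _ _ =>
            mul_nonneg h.p_nonneg (h.weighting.nonneg w c)).trans (h.sum_neighbors_le h0)
        have h3 := mul_le_mul_of_nonneg_left (add_le_add h1 h2) (h.boosted_nonneg u c)
        linarith [h.boosted_le u c]
    have h2 := sum_le_sum this
    rw [← mul_sum] at h2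
    linarith [h.ρ_le_one]
  · have hB : 0 ≤ Real.exp (-p + p * (K / D)) / (1 - p * ρ) :=
      div_nonneg (Real.exp_pos _).le (by linarith)
    refine le_trans ?_ (mul_le_mul_of_nonneg_right hdeg hB)
    rw [sum_mul]
    refine sum_le_sum fun u _ => ?_
    rw [outerBlockers, prod_union (disjoint_outerBlockers i c u), prod_product, prod_product]
    simp only [prod_singleton, rate]
    rcases (h.weighting.nonneg u c).eq_or_lt with h0 | h0
    · rw [boosted_eq_zero h0.symm, ← h0, zero_mul, zero_mul]
    · have hsub : N i u ⊆ neighbors N u := subset_biUnion_of_mem (fun i => N i u) (mem_univ i)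
      -- The factors outside `G_i` cancel against the probability of no outer removal; only the
      -- factors inside `G_i` stay in the denominator, and their product is at least `1 - pρ`.
      have hkeep : keep N x p u c = (∏ w ∈ neighbors N u \ N i u, (1 - p * x w c))
          * ∏ w ∈ N i u, (1 - p * x w c) := (prod_sdiff hsub).symm
      have hkpos : 0 < keep N x p u c := by linarith [h.half_le_keep h0]
      have hin : 1 - p * ρ ≤ ∏ w ∈ N i u, (1 - p * x w c) := by
        refine le_trans ?_ (one_sub_sum_le_prod_one_sub _
          (fun w _ => mul_nonneg h.p_nonneg (h.weighting.nonneg w c)) fun w _ => h.mul_le_one w c)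
        rw [← mul_sum]
        have := mul_le_mul_of_nonneg_left (h.weighting.color_degree_le i u c h0) h.p_nonneg
        linarith
      have hothers : ∏ d ∈ univ.erase c, (1 - p * x u d) ≤ Real.exp (-p + p * (K / D)) := by
        have h1 : ∏ d ∈ univ.erase c, (1 - p * x u d)
            ≤ ∏ d ∈ univ.erase c, Real.exp (-(p * x u d)) :=
          prod_le_prod (fun d _ => by linarith [h.mul_le_one u d])
            fun d _ => Real.one_sub_le_exp_neg _
        refine h1.trans ?_
        rw [← Real.exp_sum, Real.exp_le_exp, sum_neg_distrib, ← mul_sum]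
        have h2 := sum_erase_add univ (fun d => x u d) (mem_univ c)
        rw [h.weighting.sum_eq_one u (h.weighting.mem_of_pos h0)] at h2
        have h3 := mul_le_mul_of_nonneg_left (h.weighting.le_div u c) h.p_nonneg
        have h4 : ∑ d ∈ univ.erase c, x u d = 1 - x u c := by linarith
        rw [h4]
        linarith
      set P := ∏ w ∈ N i u, (1 - p * x w c) with hP
      set Q := ∏ w ∈ neighbors N u \ N i u, (1 - p * x w c) with hQ
      have hPpos : 0 < P := by linarith
      have hQne : Q ≠ 0 := fun hz => hkpos.ne' (by rw [hkeep, hz, zero_mul])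
      have e1 : boosted N x p u c * ((∏ d ∈ univ.erase c, (1 - p * x u d)) * Q)
          = x u c * ((∏ d ∈ univ.erase c, (1 - p * x u d)) / P) := by
        rw [boosted, hkeep]
        field_simp
      rw [e1]
      refine mul_le_mul_of_nonneg_left ?_ h0.le
      have h5 : 0 < 1 - p * ρ := by linarith
      gcongr

/-- Bounded differences are too weak here, since one proposal can cause conflicts at many neighbors
of `v`. Instead, conflicts in different colors are independent, and each color is handled by
`expect_exp_conflicts_le`. In the mean, 6 is the 3 of that bound times the 2 of `boosted_le`. -/
theorem prob_le_conflictWeight (h : IsRound N x U C D M K ρ p) {δ : ℝ} (hδ : 0 ≤ δ)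
    (hδ1 : δ ≤ 1) (i : ι) {v : V} {c : α} (hv : 0 < x v c) :
    prob (bits (rate x p))
      {ω | 6 * C * p ^ 2 * ρ ^ 2 + δ ≤ conflictWeight N x p ω i v c}
      ≤ Real.exp (-(δ ^ 2 / (24 * C * K ^ 2) * D)) := by
  have hC : (1 : ℝ) ≤ C := by exact_mod_cast h.one_le_C
  have hK := h.one_le_K
  have hD := h.one_le_D
  have hμ := isProbWeight_bits h.rate_nonneg h.rate_le_one
  -- Chosen so that `b ≤ 1/(4K)`; with rates at most `K/D` and at most `D` neighbors, the sum of `2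
  -- * (q * b)` is then at most `1/2`.
  set s : ℝ := D / (8 * K ^ 2) with hs
  have hs0 : 0 ≤ s := by positivity
  let b : V → ℝ := fun u => s * boosted N x p u c
  have hb0 : ∀ u, 0 ≤ b u := fun u => mul_nonneg hs0 (h.boosted_nonneg u c)
  have hbK : ∀ u, b u ≤ 1 / (4 * K) := by
    intro u
    have h1 := mul_le_mul_of_nonneg_left (h.boosted_le_div u c) hs0
    have e : s * (2 * K / D) = 1 / (4 * K) := by
      rw [hs]
      field_simp
      norm_num
    linarith
  have hb4 : ∀ u, b u ≤ 1 / 4 := fun u => (hbK u).trans (by gcongr; linarith)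
  let Y : α → (V × α → Bool) → ℝ := fun d ω => Real.exp (∑ e ∈ N i v ×ˢ {d},
    b e.1 * if ω e = true ∧ ∃ w ∈ blockers N e.1 e.2, ω w = true then 1 else 0)
  have hY : ∀ d, expect (bits (rate x p)) (Y d)
      ≤ Real.exp (3 * ∑ u ∈ N i v, b u * (p * x u d * (p * (C * ρ)))) := by
    intro d
    have hmain := expect_exp_conflicts_le (q := rate x p) (b := fun e : V × α => b e.1)
      h.rate_nonneg h.rate_le_one (N i v ×ˢ {d}) (fun e => blockers N e.1 e.2) ?_
      (fun e => hb0 e.1) (fun e => hb4 e.1) ?_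
    · refine hmain.trans ?_
      rw [Real.exp_le_exp, sum_product]
      simp only [sum_singleton, rate, blockers, sum_product]
      refine mul_le_mul_of_nonneg_left (sum_le_sum fun u _ => ?_) (by norm_num)
      refine mul_le_mul_of_nonneg_left ?_ (hb0 u)
      rcases (h.weighting.nonneg u d).eq_or_lt with h0 | h0
      · rw [← h0, mul_zero, zero_mul, zero_mul]
      · refine mul_le_mul_of_nonneg_left ?_ (mul_nonneg h.p_nonneg h0.le)
        rw [← mul_sum]
        exact mul_le_mul_of_nonneg_left (h.weighting.sum_neighbors_le h.family h.ρ_nonneg h0)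
          h.p_nonneg
    · intro e he
      simp only [blockers, mem_product] at he
      exact h.family.notMem_neighbors _ he.1
    · rw [sum_product]
      simp only [sum_singleton, rate]
      have h1 : ∀ u ∈ N i v, 2 * (p * x u d * b u) ≤ 1 / (2 * D) := by
        intro u _
        have h2 : p * x u d ≤ K / D :=
          (mul_le_of_le_one_left (h.weighting.nonneg u d) h.p_le_one).trans
            (h.weighting.le_div u d)
        have h3 := mul_le_mul h2 (hbK u) (hb0 u) (by positivity)
        have e : K / D * (1 / (4 * K)) = 1 / (2 * D) / 2 := by
          field_simp
          norm_num
        linarith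
      refine (sum_le_card_nsmul _ _ _ h1).trans ?_
      rw [nsmul_eq_mul]
      have h2 : ((N i v).card : ℝ) * (1 / (2 * D)) ≤ D * (1 / (2 * D)) := by
        have := h.family.card_le i v
        gcongr
      refine h2.trans (le_of_eq ?_)
      field_simp
  -- A vertex in conflict is counted for at least one color `d`.
  have hdom : ∀ ω, Real.exp (s * conflictWeight N x p ω i v c) ≤ ∏ d, Y d ω := by
    intro ω
    rw [← Real.exp_sum, Real.exp_le_exp, conflictWeight, mul_sum]
    simp only [sum_product, sum_singleton]
    rw [sum_comm]
    refine sum_le_sum fun u _ => ?_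
    rw [← mul_assoc, ← mul_sum]
    refine mul_le_mul_of_nonneg_left ?_ (hb0 u)
    by_cases hd : ∃ d, ω (u, d) = true ∧ ∃ w ∈ neighbors N u, ω (w, d) = true
    · rw [if_pos hd]
      obtain ⟨d, hd1, w, hw, hw'⟩ := hd
      refine le_trans (le_of_eq ?_) (single_le_sum (fun d _ => ?_) (mem_univ d))
      · rw [if_pos ⟨hd1, (w, d), by simp [blockers, hw], hw'⟩]
      · positivity
    · rw [if_neg hd]
      positivity
  have hexp : expect (bits (rate x p)) (fun ω => Real.exp (s * conflictWeight N x p ω i v c))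
      ≤ Real.exp (s * (6 * C * p ^ 2 * ρ ^ 2)) := by
    refine (expect_mono hμ hdom).trans ?_
    rw [expect_prod_of_pairwise_disjoint hμ univ Y (fun d => {e | e.2 = d})]
    · refine (prod_le_prod (fun d _ => expect_nonneg hμ fun ω => (Real.exp_pos _).le)
        fun d _ => hY d).trans ?_
      rw [← Real.exp_sum, Real.exp_le_exp, ← mul_sum, sum_comm]
      have h1 : ∀ u ∈ N i v, ∑ d, b u * (p * x u d * (p * (C * ρ)))
          ≤ 2 * s * (p ^ 2 * C * ρ) * x u c := by
        intro u _
        have e : ∑ d, b u * (p * x u d * (p * (C * ρ))) = b u * (p ^ 2 * C * ρ) * ∑ d, x u d := by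
          rw [mul_sum]
          exact sum_congr rfl fun d _ => by ring
        rw [e]
        have hnn : 0 ≤ p ^ 2 * C * ρ := by
          have := h.p_nonneg
          have := h.ρ_nonneg
          positivity
        refine (mul_le_of_le_one_right (mul_nonneg (hb0 u) hnn)
          (h.weighting.sum_le_one u)).trans ?_
        have h2 := mul_le_mul_of_nonneg_right
          (mul_le_mul_of_nonneg_left (h.boosted_le u c) hs0) hnn
        linarith
      have h2 := sum_le_sum h1
      rw [← mul_sum] at h2
      have h3 : 2 * s * (p ^ 2 * C * ρ) * ∑ u ∈ N i v, x u c ≤ 2 * s * (p ^ 2 * C * ρ) * ρ := by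
        refine mul_le_mul_of_nonneg_left (h.weighting.color_degree_le i v c hv) ?_
        have := h.p_nonneg
        have := h.ρ_nonneg
        positivity
      linarith
    · intro d ω ω' hω
      simp only [Y]
      congr 1
      refine sum_congr rfl fun e he => ?_
      obtain ⟨u, d'⟩ := e
      simp only [mem_product, mem_singleton] at he
      obtain ⟨-, rfl⟩ := he
      have e1 : ω (u, d') = ω' (u, d') := hω _ rfl
      have e2 : (∃ w ∈ blockers N u d', ω w = true) ↔ ∃ w ∈ blockers N u d', ω' w = true := by
        refine exists_congr fun w => and_congr_right fun hw => ?_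
        rw [hω w]
        simp only [blockers, mem_product, mem_singleton] at hw
        exact hw.2
      simp only [e1, e2]
    · intro d d' hdd
      rw [Function.onFun, Set.disjoint_left]
      intro e h1 h2
      exact hdd (h1.symm.trans h2)
  refine (prob_le_of_expect_exp_le hμ hs0 hexp).trans ?_
  rw [Real.exp_le_exp]
  have h1 : δ ^ 2 / (24 * C * K ^ 2) * D ≤ s * δ := by
    have h2 : δ ^ 2 / (24 * C * K ^ 2) ≤ δ / (8 * K ^ 2) := by
      have : δ ^ 2 ≤ δ := by nlinarith
      gcongr
      linarith
    calc _ ≤ δ / (8 * K ^ 2) * D := by gcongr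
      _ = s * δ := by rw [hs]; ring
  linarith

end IsRound

end NibbleColoring

/-! ### One round: the local lemma and the reduced problem. -/

namespace NibbleColoring

open Finset ProductExpectation

variable {V ι α : Type*} [Fintype V] [DecidableEq V] [Fintype ι] [DecidableEq ι]
  [Fintype α] [DecidableEq α]

lemma card_biUnion_le_mul {κ τ : Type*} [DecidableEq τ] {s : Finset κ} {F : κ → Finset τ} {r : ℝ}
    (h : ∀ k ∈ s, ((F k).card : ℝ) ≤ r) : ((s.biUnion F).card : ℝ) ≤ s.card * r := by
  calc ((s.biUnion F).card : ℝ) ≤ ((∑ k ∈ s, (F k).card : ℕ) : ℝ) := by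
        exact_mod_cast card_biUnion_le
    _ = ∑ k ∈ s, ((F k).card : ℝ) := by push_cast; rfl
    _ ≤ s.card • r := sum_le_card_nsmul _ _ _ h
    _ = s.card * r := nsmul_eq_mul _ _

/-- The vertices at distance at most one from `v`. -/
def closedNeighbors (N : ι → V → Finset V) (v : V) : Finset V := insert v (neighbors N v)

/-- The vertices at distance at most two from `v`. -/
def ball (N : ι → V → Finset V) (v : V) : Finset V :=
  (closedNeighbors N v).biUnion (closedNeighbors N)

variable {N : ι → V → Finset V} {x : V → α → ℝ} {U : Finset V} {C : ℕ} {D M K ρ p : ℝ}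

set_option linter.unusedSectionVars false

namespace IsNearlyDisjointFamily

lemma mem_closedNeighbors_symm (hN : IsNearlyDisjointFamily N C D) {u v : V}
    (h : u ∈ closedNeighbors N v) : v ∈ closedNeighbors N u := by
  rw [closedNeighbors, mem_insert] at *
  exact h.imp Eq.symm hN.neighbors_symm

lemma mem_ball_symm (hN : IsNearlyDisjointFamily N C D) {u v : V} (h : u ∈ ball N v) :
    v ∈ ball N u := by
  rw [ball, mem_biUnion] at *
  obtain ⟨w, hw, hw'⟩ := h
  exact ⟨w, hN.mem_closedNeighbors_symm hw', hN.mem_closedNeighbors_symm hw⟩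

lemma card_closedNeighbors_le (hN : IsNearlyDisjointFamily N C D) (hD : 0 ≤ D) (v : V) :
    ((closedNeighbors N v).card : ℝ) ≤ 1 + C * D := by
  have h1 : ((closedNeighbors N v).card : ℝ) ≤ (neighbors N v).card + 1 := by
    exact_mod_cast card_insert_le _ _
  linarith [hN.card_neighbors_le hD v]

lemma card_ball_le (hN : IsNearlyDisjointFamily N C D) (hD : 0 ≤ D) (v : V) :
    ((ball N v).card : ℝ) ≤ (1 + C * D) ^ 2 := by
  refine (card_biUnion_le_mul fun w _ => hN.card_closedNeighbors_le hD w).trans ?_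
  rw [sq]
  have := hN.card_closedNeighbors_le hD v
  gcongr

lemma card_biUnion_ball_le (hN : IsNearlyDisjointFamily N C D) (hD : 0 ≤ D) (v : V) :
    (((ball N v).biUnion (ball N)).card : ℝ) ≤ (1 + C * D) ^ 4 := by
  refine (card_biUnion_le_mul fun w _ => hN.card_ball_le hD w).trans ?_
  have e : (1 + C * D) ^ 4 = (1 + C * D) ^ 2 * (1 + C * D) ^ 2 := by ring
  rw [e]
  have := hN.card_ball_le hD v
  gcongr

end IsNearlyDisjointFamily

lemma mem_ball_of_mem_neighbors {u v : V} (h : u ∈ neighbors N v) : u ∈ ball N v :=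
  mem_biUnion.mpr ⟨v, mem_insert_self _ _, mem_insert_of_mem h⟩

lemma mem_ball_of_mem_neighbors_neighbors {u v w : V} (h : u ∈ neighbors N v)
    (h' : w ∈ neighbors N u) : w ∈ ball N v :=
  mem_biUnion.mpr ⟨u, mem_insert_of_mem h, mem_insert_of_mem h'⟩

lemma subset_neighbors (i : ι) (v : V) : N i v ⊆ neighbors N v :=
  subset_biUnion_of_mem (fun i => N i v) (mem_univ i)

lemma dependsOn_survivingWeight (v : V) :
    DependsOn (fun ω : V × α → Bool => survivingWeight N x p ω v) {e | e.1 ∈ ball N v} := by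
  intro ω ω' h
  refine sum_congr rfl fun c _ => ?_
  have : (∀ e ∈ blockers N v c, ω e = false) ↔ ∀ e ∈ blockers N v c, ω' e = false := by
    refine forall₂_congr fun e he => ?_
    rw [h e (mem_ball_of_mem_neighbors (mem_product.mp he).1)]
  simp only [this]

lemma dependsOn_idleWeight (i : ι) (v : V) (c : α) :
    DependsOn (fun ω : V × α → Bool => idleWeight N x p ω i v c) {e | e.1 ∈ ball N v} := by
  intro ω ω' h
  refine sum_congr rfl fun u hu => ?_
  have hu' := subset_neighbors i v hu
  have : (∀ e ∈ outerBlockers N i c u, ω e = false) ↔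
      ∀ e ∈ outerBlockers N i c u, ω' e = false := by
    refine forall₂_congr fun e he => ?_
    rw [h e]
    simp only [outerBlockers, mem_union, mem_product, mem_singleton, mem_sdiff] at he
    rcases he with he | he
    · rw [Set.mem_ofPred_eq, he.1]
      exact mem_ball_of_mem_neighbors hu'
    · exact mem_ball_of_mem_neighbors_neighbors hu' he.1.1
  simp only [this]

lemma dependsOn_conflictWeight (i : ι) (v : V) (c : α) :
    DependsOn (fun ω : V × α → Bool => conflictWeight N x p ω i v c) {e | e.1 ∈ ball N v} := by
  intro ω ω' h
  refine sum_congr rfl fun u hu => ?_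
  have hu' := subset_neighbors i v hu
  have : (∃ d, ω (u, d) = true ∧ ∃ w ∈ neighbors N u, ω (w, d) = true) ↔
      ∃ d, ω' (u, d) = true ∧ ∃ w ∈ neighbors N u, ω' (w, d) = true := by
    refine exists_congr fun d => and_congr ?_ (exists_congr fun w => and_congr_right fun hw => ?_)
    · rw [h (u, d) (mem_ball_of_mem_neighbors hu')]
    · rw [h (w, d) (mem_ball_of_mem_neighbors_neighbors hu' hw)]
  simp only [this]

/-- The events to be avoided in a round: at a vertex, the loss of too much weight; at a vertex, a
graph and a color, too much weight on uncolored neighbors. -/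
noncomputable def badEvent (N : ι → V → Finset V) (x : V → α → ℝ) (C : ℕ) (D K ρ p δ : ℝ)
    (k : V × Option (ι × α)) : Set (V × α → Bool) :=
  k.2.elim {ω | survivingWeight N x p ω k.1 ≤ 1 - δ} fun y =>
    {ω | ρ * (Real.exp (-p + p * (K / D)) / (1 - p * ρ)) + δ ≤ idleWeight N x p ω y.1 k.1 y.2} ∪
      {ω | 6 * C * p ^ 2 * ρ ^ 2 + δ ≤ conflictWeight N x p ω y.1 k.1 y.2}

lemma dependsOn_badEvent (δ : ℝ) (k : V × Option (ι × α)) :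
    DependsOn (· ∈ badEvent N x C D K ρ p δ k) {e | e.1 ∈ ball N k.1} := by
  obtain ⟨v, _ | ⟨i, c⟩⟩ := k
  · intro ω ω' h
    have := dependsOn_survivingWeight (x := x) (p := p) v h
    simp only at this
    simp only [badEvent, Option.elim, Set.mem_ofPred_eq, this]
  · intro ω ω' h
    have h1 := dependsOn_idleWeight (x := x) (p := p) i v c h
    have h2 := dependsOn_conflictWeight (x := x) (p := p) i v c h
    simp only at h1 h2
    simp only [badEvent, Option.elim, Set.mem_union, Set.mem_ofPred_eq, h1, h2]

namespace IsRound

/-- In every round there is an outcome that avoids all bad events. -/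
theorem exists_outcome (h : IsRound N x U C D M K ρ p) {δ : ℝ} (hδ : 0 ≤ δ) (hδ1 : δ ≤ 1)
    (hM : 0 ≤ M)
    (hlll : (1 + C * D) ^ 4 * (1 + C * (M * D)) *
      (2 * Real.exp (-(δ ^ 2 / (24 * C * K ^ 2) * D))) ≤ 1 / 4) :
    ∃ ω : V × α → Bool, (∀ v c, ω (v, c) = true → 0 < x v c) ∧
      (∀ v ∈ U, 1 - δ < survivingWeight N x p ω v) ∧
      ∀ i v c, 0 < x v c → (N i v).Nonempty →
        idleWeight N x p ω i v c + conflictWeight N x p ω i v c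
          ≤ ρ * (Real.exp (-p + p * (K / D)) / (1 - p * ρ)) + 6 * C * p ^ 2 * ρ ^ 2 + 2 * δ := by
  classical
  have hμ := isProbWeight_bits h.rate_nonneg h.rate_le_one
  have hD := h.one_le_D
  set q := 2 * Real.exp (-(δ ^ 2 / (24 * C * K ^ 2) * D)) with hq
  have hq0 : 0 ≤ q := by positivity
  let T : Finset (V × Option (ι × α)) := univ.filter fun k =>
    k.2.elim (k.1 ∈ U) fun y => 0 < x k.1 y.2 ∧ (N y.1 k.1).Nonempty
  have hprob : ∀ k ∈ T, prob (bits (rate x p)) (badEvent N x C D K ρ p δ k) ≤ q := by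
    rintro ⟨v, _ | ⟨i, c⟩⟩ hk
    · replace hk : v ∈ U := (mem_filter.mp hk).2
      have := h.prob_survivingWeight_le hδ hδ1 hk
      refine this.trans ?_
      rw [hq]
      linarith [Real.exp_pos (-(δ ^ 2 / (24 * C * K ^ 2) * D))]
    · replace hk : 0 < x v c ∧ (N i v).Nonempty := (mem_filter.mp hk).2
      refine (prob_union_le hμ _ _).trans ?_
      rw [hq]
      linarith [h.prob_le_idleWeight hδ hδ1 i hk.1, h.prob_le_conflictWeight hδ hδ1 i hk.1]
  have hfac1 : 1 ≤ (1 + C * D) ^ 4 := one_le_pow₀ (by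
    have : 0 ≤ C * D := by positivity
    linarith)
  have hfac2 : 1 ≤ 1 + C * (M * D) := by
    have : 0 ≤ C * (M * D) := by positivity
    linarith
  have hq4 : q ≤ 1 / 4 := by
    refine le_trans ?_ hlll
    have : 1 ≤ (1 + C * D) ^ 4 * (1 + C * (M * D)) := one_le_mul_of_one_le_of_one_le hfac1 hfac2
    nlinarith
  have hex := exists_avoiding_all hμ (badEvent N x C D K ρ p δ) (fun k => {e | e.1 ∈ ball N k.1}) T
    (fun k _ => dependsOn_badEvent δ k) (fun k hk => (hprob k hk).trans hq4) ?_
  · obtain ⟨ω, hpos, hω⟩ := hex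
    refine ⟨ω, ?_, ?_, ?_⟩
    · intro v c hvc
      refine lt_of_le_of_ne (h.weighting.nonneg v c) fun h0 => hpos.ne' ?_
      refine prod_eq_zero (mem_univ (v, c)) ?_
      simp [bits, hvc, rate, ← h0]
    · intro v hv
      have := hω (v, none) (by simpa [T] using hv)
      simpa [badEvent] using this
    · intro i v c hvc hne
      have := hω (v, some (i, c)) (by simpa [T] using ⟨hvc, hne⟩)
      simp only [badEvent, Option.elim, Set.mem_union, Set.mem_ofPred_eq, not_or, not_le] at this
      linarith [this.1, this.2]
  · rintro ⟨v, y⟩ - T' hT' hdis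
    refine (sum_le_card_nsmul _ _ q fun l hl => hprob l (hT' hl)).trans (le_trans ?_ hlll)
    rw [nsmul_eq_mul]
    refine mul_le_mul_of_nonneg_right ?_ hq0
    -- The relevant events at one vertex: one for its total weight, and one for each pair of a graph
    -- (at most `C`) and a color in its support (at most `MD`). Dependent events sit at vertices
    -- whose balls of radius two meet, hence the fourth power.
    let fiber : V → Finset (V × Option (ι × α)) := fun w => insert (w, none)
      (((univ.filter fun i => (N i w).Nonempty) ×ˢ (univ.filter fun c => 0 < x w c)).image
        fun y => (w, some y))
    have hfiber : ∀ w, ((fiber w).card : ℝ) ≤ 1 + C * (M * D) := by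
      intro w
      have h1 : ((fiber w).card : ℝ) ≤ ((univ.filter fun i => (N i w).Nonempty).card
          * (univ.filter fun c => 0 < x w c).card : ℕ) + 1 := by
        refine le_trans (Nat.cast_le.mpr (card_insert_le _ _)) ?_
        push_cast
        have := card_image_le (s := (univ.filter fun i => (N i w).Nonempty) ×ˢ
          (univ.filter fun c => 0 < x w c)) (f := fun y => ((w, some y) : V × Option (ι × α)))
        rw [card_product] at this
        have h2 : ((((univ.filter fun i => (N i w).Nonempty) ×ˢ
          (univ.filter fun c => 0 < x w c)).image
            fun y => ((w, some y) : V × Option (ι × α))).card : ℝ)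
            ≤ (univ.filter fun i => (N i w).Nonempty).card
              * (univ.filter fun c => 0 < x w c).card := by exact_mod_cast this
        linarith
      push_cast at h1
      have h2 : ((univ.filter fun i => (N i w).Nonempty).card : ℝ) ≤ C := by
        exact_mod_cast h.family.index_le w
      have h3 := h.weighting.support_le w
      have := mul_le_mul h2 h3 (Nat.cast_nonneg _) (Nat.cast_nonneg C)
      linarith
    have hsub : T' ⊆ ((ball N v).biUnion (ball N)).biUnion fiber := by
      rintro ⟨w, y'⟩ hl
      have hd := hdis _ hl
      rw [Set.not_disjoint_iff] at hd
      obtain ⟨e, he1, he2⟩ := hd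
      refine mem_biUnion.mpr ⟨w, mem_biUnion.mpr ⟨e.1, he1, h.family.mem_ball_symm he2⟩, ?_⟩
      have hT := hT' hl
      rcases y' with _ | ⟨i, c⟩
      · exact mem_insert_self _ _
      · replace hT : 0 < x w c ∧ (N i w).Nonempty := (mem_filter.mp hT).2
        refine mem_insert_of_mem (mem_image.mpr ⟨(i, c), ?_, rfl⟩)
        simpa using ⟨hT.2, hT.1⟩
    calc (T'.card : ℝ) ≤ (((ball N v).biUnion (ball N)).biUnion fiber).card := by
          exact_mod_cast card_le_card hsub
      _ ≤ ((ball N v).biUnion (ball N)).card * (1 + C * (M * D)) :=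
          card_biUnion_le_mul fun w _ => hfiber w
      _ ≤ _ := by
          have := h.family.card_biUnion_ball_le (by linarith) v
          gcongr

/-- One round reduces the coloring problem to one with color degree `ρ'`. -/
theorem exists_next (h : IsRound N x U C D M K ρ p) {δ ρ' : ℝ} (hδ : 0 ≤ δ) (hδ1 : δ ≤ 1 / 2)
    (hM : 0 ≤ M) (hρ' : 0 ≤ ρ')
    (hstep : ρ * (Real.exp (-p + p * (K / D)) / (1 - p * ρ)) + 6 * C * p ^ 2 * ρ ^ 2 + 2 * δ
      ≤ ρ' * (1 - δ))
    (hlll : (1 + C * D) ^ 4 * (1 + C * (M * D)) *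
      (2 * Real.exp (-(δ ^ 2 / (24 * C * K ^ 2) * D))) ≤ 1 / 4) :
    ∃ (x' : V → α → ℝ) (U' : Finset V), IsWeighting N x' U' D M (4 * K) ρ' ∧
      (HasWeightedColoring N x' U' → HasWeightedColoring N x U) := by
  classical
  obtain ⟨ω, hfire, hsurv, hdeg⟩ := h.exists_outcome hδ (by linarith) hM hlll
  let Free : V → α → Prop := fun v c => ∀ e ∈ blockers N v c, ω e = false
  let Colored : V → Prop := fun v => ∃ c, ω (v, c) = true ∧ Free v c
  let U' := U.filter fun v => ¬ Colored v
  let y : V → α → ℝ := fun v c => boosted N x p v c * (if Free v c then 1 else 0)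
  let Z : V → ℝ := fun v => survivingWeight N x p ω v
  have hZ : ∀ v, ∑ c, y v c = Z v := fun v => rfl
  have hZpos : ∀ v ∈ U, 1 - δ < Z v := hsurv
  have hy0 : ∀ v c, 0 ≤ y v c := fun v c =>
    mul_nonneg (h.boosted_nonneg v c) (by split_ifs <;> norm_num)
  let x' : V → α → ℝ := fun v c => if v ∈ U' then y v c / Z v else 0
  have hU'U : ∀ v ∈ U', v ∈ U := fun v hv => (mem_filter.mp hv).1
  have hx'pos : ∀ v c, 0 < x' v c → v ∈ U' ∧ 0 < x v c ∧ Free v c := by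
    intro v c hvc
    by_cases hv : v ∈ U'
    · refine ⟨hv, ?_, ?_⟩
      · refine lt_of_le_of_ne (h.weighting.nonneg v c) fun h0 => hvc.ne' ?_
        simp only [x', hv, if_true, y, boosted_eq_zero h0.symm, zero_mul, zero_div]
      · by_contra hF
        refine hvc.ne' ?_
        simp only [x', hv, if_true, y, hF, if_false, mul_zero, zero_div]
    · simp [x', hv] at hvc
  have hx'le : ∀ v c, x' v c * (1 - δ) ≤ if v ∈ U' then y v c else 0 := by
    intro v c
    by_cases hv : v ∈ U'
    · simp only [x', hv, if_true]
      have := hZpos v (hU'U v hv)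
      rw [div_mul_eq_mul_div, div_le_iff₀ (by linarith)]
      exact mul_le_mul_of_nonneg_left this.le (hy0 v c)
    · simp [x', hv]
  refine ⟨x', U', ⟨?_, ?_, ?_, ?_, ?_, ?_⟩, ?_⟩
  · intro v c
    by_cases hv : v ∈ U'
    · simp only [x', hv, if_true]
      exact div_nonneg (hy0 v c) (by linarith [hZpos v (hU'U v hv)])
    · simp [x', hv]
  · intro v hv c
    simp [x', hv]
  · intro v hv
    simp only [x', hv, if_true]
    rw [← sum_div, hZ, div_self]
    linarith [hZpos v (hU'U v hv)]
  · intro i v c hvc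
    obtain ⟨hv, hxv, hF⟩ := hx'pos v c hvc
    rcases (N i v).eq_empty_or_nonempty with hne | hne
    · rw [hne, sum_empty]
      exact hρ'
    · have h1 : (∑ u ∈ N i v, x' u c) * (1 - δ)
          ≤ idleWeight N x p ω i v c + conflictWeight N x p ω i v c := by
        rw [sum_mul, idleWeight, conflictWeight, ← sum_add_distrib]
        refine sum_le_sum fun u hu => (hx'le u c).trans ?_
        rw [← mul_add]
        have hnn : (0 : ℝ) ≤ (if ∀ e ∈ outerBlockers N i c u, ω e = false then 1 else 0)
            + (if ∃ d, ω (u, d) = true ∧ ∃ w ∈ neighbors N u, ω (w, d) = true then 1 else 0) := by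
          positivity
        split_ifs with huU hall hconf hconf
        · refine mul_le_mul_of_nonneg_left ?_ (h.boosted_nonneg u c)
          split_ifs <;> norm_num
        · refine mul_le_mul_of_nonneg_left ?_ (h.boosted_nonneg u c)
          split_ifs <;> norm_num
        · refine mul_le_mul_of_nonneg_left ?_ (h.boosted_nonneg u c)
          split_ifs <;> norm_num
        · refine mul_le_mul_of_nonneg_left ?_ (h.boosted_nonneg u c)
          rw [if_neg]
          · norm_num
          · intro hFu
            have hnc : ¬ Colored u := (mem_filter.mp huU).2
            refine hall fun e he => ?_
            obtain ⟨w, d⟩ := e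
            simp only [outerBlockers, mem_union, mem_product, mem_singleton, mem_sdiff] at he
            rcases he with he | he
            · obtain ⟨rfl, -⟩ := he
              by_contra hd
              rw [Bool.not_eq_false] at hd
              refine hnc ⟨d, hd, fun e he => ?_⟩
              by_contra hed
              rw [Bool.not_eq_false] at hed
              obtain ⟨w', d'⟩ := e
              simp only [blockers, mem_product, mem_singleton] at he
              obtain ⟨hw', rfl⟩ := he
              exact hconf ⟨_, hd, w', hw', hed⟩
            · obtain ⟨⟨hw, -⟩, rfl⟩ := he
              exact hFu (w, d) (by simp [blockers, hw])
        all_goals exact mul_nonneg (h.boosted_nonneg u c) (by norm_num)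
      have h2 := hdeg i v c hxv hne
      have h3 : (∑ u ∈ N i v, x' u c) * (1 - δ) ≤ ρ' * (1 - δ) := by linarith
      exact le_of_mul_le_mul_right h3 (by linarith)
  · intro v c
    have hKD : 0 ≤ 4 * K / D := by
      have := h.one_le_K
      have := h.one_le_D
      positivity
    have h1 := hx'le v c
    by_cases hv : v ∈ U'
    · rw [if_pos hv] at h1
      have h2 : y v c ≤ 2 * K / D := by
        refine le_trans ?_ (h.boosted_le_div v c)
        refine mul_le_of_le_one_right (h.boosted_nonneg v c) ?_
        split_ifs <;> norm_num
      -- One factor 2 comes from the boost, the other from dividing by a total weight above `1 - δ ≥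
      -- 1/2`.
      have h3 : 4 * K / D = 2 * (2 * K / D) := by ring
      rw [h3]
      by_contra hcon
      push Not at hcon
      have hKD2 : 0 ≤ 2 * K / D := by linarith
      nlinarith
    · simp only [x', hv, if_false]
      exact hKD
  · intro v
    refine le_trans ?_ (h.weighting.support_le v)
    exact_mod_cast card_le_card fun c hc => by
      simp only [mem_filter, mem_univ, true_and] at *
      exact (hx'pos v c hc).2.1
  · rintro ⟨φ, hφ1, hφ2⟩
    have hcol : ∀ v, Colored v → ∃ c, ω (v, c) = true ∧ Free v c := fun v hv => hv
    let ψ : V → α := fun v => if hv : Colored v then (hcol v hv).choose else φ v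
    have hψ : ∀ v, Colored v → ω (v, ψ v) = true ∧ Free v (ψ v) := by
      intro v hv
      simp only [ψ, hv, dif_pos]
      exact (hcol v hv).choose_spec
    have hψ' : ∀ v, ¬ Colored v → ψ v = φ v := fun v hv => by simp [ψ, hv]
    -- Every final color has survived the round, so no neighbor was even proposed it; this excludes
    -- clashes that involve a vertex colored in this round.
    have hfree : ∀ v ∈ U, Free v (ψ v) := by
      intro v hv
      by_cases hc : Colored v
      · exact (hψ v hc).2
      · rw [hψ' v hc]
        exact (hx'pos v _ (hφ1 v (mem_filter.mpr ⟨hv, hc⟩))).2.2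
    refine ⟨ψ, ?_, ?_⟩
    · intro v hv
      by_cases hc : Colored v
      · exact hfire _ _ (hψ v hc).1
      · rw [hψ' v hc]
        exact (hx'pos v _ (hφ1 v (mem_filter.mpr ⟨hv, hc⟩))).2.1
    · intro u hu v hv huv heq
      by_cases hcu : Colored u
      · have := hfree v hv (u, ψ v) (by simp [blockers, huv])
        rw [← heq, (hψ u hcu).1] at this
        simp at this
      · by_cases hcv : Colored v
        · have := hfree u hu (v, ψ u) (by simp [blockers, h.family.neighbors_symm huv])
          rw [heq, (hψ v hcv).1] at this
          simp at this
        · rw [hψ' u hcu, hψ' v hcv] at heq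
          exact hφ2 u (mem_filter.mpr ⟨hu, hcu⟩) v (mem_filter.mpr ⟨hv, hcv⟩) huv heq

end IsRound

end NibbleColoring

/-! ### Choice of parameters and iteration of the rounds. -/

namespace NibbleColoring

open Finset ProductExpectation Filter

lemma eventually_local_lemma_condition (C : ℕ) {M κ : ℝ} (hM : 0 ≤ M) (hκ : 0 < κ) :
    ∀ᶠ D : ℝ in atTop,
      (1 + C * D) ^ 4 * (1 + C * (M * D)) * (2 * Real.exp (-(κ * D))) ≤ 1 / 4 := by
  have h1 := (tendsto_rpow_mul_exp_neg_mul_atTop_nhds_zero 5 κ hκ).const_mul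
    (2 * ((1 + C : ℝ) ^ 4 * (1 + C * M)))
  rw [mul_zero] at h1
  filter_upwards [h1.eventually_le_const (by norm_num : (0 : ℝ) < 1 / 4), eventually_ge_atTop 1]
    with D hD hD1
  refine le_trans ?_ hD
  have e1 : 1 + C * D ≤ (1 + C) * D := by nlinarith
  have e2 : 1 + C * (M * D) ≤ (1 + C * M) * D := by nlinarith
  have hCM : 0 ≤ C * (M * D) := by positivity
  have e3 : (1 + C * D) ^ 4 * (1 + C * (M * D)) ≤ ((1 + C) * D) ^ 4 * ((1 + C * M) * D) := by
    gcongr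
  have e4 : D ^ (5 : ℝ) = D ^ 5 := by exact_mod_cast Real.rpow_natCast D 5
  rw [e4]
  have e5 := mul_le_mul_of_nonneg_right e3
    (by positivity : 0 ≤ 2 * Real.exp (-(κ * D)))
  refine e5.trans (le_of_eq ?_)
  rw [neg_mul]
  ring

lemma eventually_exp_div_le (K p : ℝ) {δ : ℝ} (hδ : 0 < δ) :
    ∀ᶠ D : ℝ in atTop, Real.exp (p * (K / D)) ≤ 1 + δ := by
  have h1 : Tendsto (fun D : ℝ => p * (K / D)) atTop (nhds 0) := by
    simpa using (tendsto_const_nhds (x := K)).div_atTop tendsto_id |>.const_mul p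
  have h2 := (Real.continuous_exp.tendsto 0).comp h1
  rw [Real.exp_zero] at h2
  exact h2.eventually_le_const (by linarith)

/-- The right side expands to `1 - p + p² + p²ρ(1-ρ-p)`, and `e^{-p} ≤ 1 - p + p²`. -/
lemma exp_neg_le_mul {p ρ : ℝ} (hp : 0 ≤ p) (hp1 : p ≤ 1) (hρ : 0 ≤ ρ) (hpρ : p ≤ 1 - ρ) :
    Real.exp (-p) ≤ (1 - p * (1 - ρ) + p ^ 2) * (1 - p * ρ) := by
  have h1 := (abs_le.mp (Real.abs_exp_sub_one_sub_id_le
    (x := -p) (by rw [abs_neg, abs_of_nonneg hp]; exact hp1))).2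
  have h2 : 0 ≤ p ^ 2 * ρ * (1 - ρ - p) := by
    have : 0 ≤ 1 - ρ - p := by linarith
    positivity
  nlinarith

/-- The color degree bound after a round, for a suitable rate `p` and error `δ`. -/
lemma next_color_degree_le {C : ℕ} {η p δ ρ e : ℝ} (hη0 : 0 < η) (hη1 : η < 1)
    (hp : p * (1 + 6 * C) = η / 4) (hp0 : 0 < p) (hδ0 : 0 < δ) (hδ : 8 * δ ≤ ρ * (p * η))
    (hρ0 : 0 ≤ ρ) (hρ1 : ρ ≤ 1 - η) (he : e ≤ 1 + δ) :
    ρ * (Real.exp (-p) * e / (1 - p * ρ)) + 6 * C * p ^ 2 * ρ ^ 2 + 2 * δ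
      ≤ ρ * (1 - p * η / 4) * (1 - δ) := by
  have hC : (0 : ℝ) ≤ C := Nat.cast_nonneg C
  have hpη : p ≤ η / 4 := by nlinarith
  have hpρ : p * ρ ≤ 1 / 4 := by nlinarith
  have h1 := exp_neg_le_mul hp0.le (by linarith) hρ0 (by linarith : p ≤ 1 - ρ)
  set G := 1 - p * (1 - ρ) + p ^ 2 with hG
  have hG1 : G ≤ 1 - p * η + p ^ 2 := by
    have := mul_le_mul_of_nonneg_left (by linarith : η ≤ 1 - ρ) hp0.le
    linarith
  have hG0 : 0 ≤ G := by
    have : p * (1 - ρ) ≤ 1 := by nlinarith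
    nlinarith
  have hGle : G ≤ 1 := by nlinarith
  have h2 : Real.exp (-p) * e / (1 - p * ρ) ≤ G * (1 + δ) := by
    rw [div_le_iff₀ (by linarith)]
    calc Real.exp (-p) * e ≤ Real.exp (-p) * (1 + δ) := by gcongr
      _ ≤ G * (1 - p * ρ) * (1 + δ) := by gcongr
      _ = _ := by ring
  have h3 := mul_le_mul_of_nonneg_left h2 hρ0
  have h4 : ρ * (G * (1 + δ)) ≤ ρ * G + δ := by
    have : ρ * G ≤ 1 := by nlinarith
    nlinarith
  have h5 : 6 * C * p ^ 2 * ρ ^ 2 ≤ ρ * (6 * C * p ^ 2) := by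
    have h6 : ρ ^ 2 ≤ ρ := by nlinarith
    have h7 : 0 ≤ 6 * C * p ^ 2 := by positivity
    nlinarith
  have h6 : ρ * (G + 6 * C * p ^ 2) ≤ ρ * (1 - 3 / 4 * (p * η)) := by
    refine mul_le_mul_of_nonneg_left ?_ hρ0
    -- The choice of `p` lets the second-order terms use a quarter of the gain `pη`. Another quarter
    -- is kept, and the remaining half absorbs errors of total size `4δ`.
    have : p ^ 2 + 6 * C * p ^ 2 = p * η / 4 := by
      calc p ^ 2 + 6 * C * p ^ 2 = p * (p * (1 + 6 * C)) := by ring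
        _ = _ := by rw [hp]; ring
    linarith
  have h7 : ρ * (1 - p * η / 4) * δ ≤ δ := by
    refine mul_le_of_le_one_left hδ0.le ?_
    have : 0 ≤ p * η := by positivity
    nlinarith
  nlinarith

universe u v w

/-- All weightings of nearly disjoint families with these parameters have a proper coloring with
colors of positive weight. -/
def AlwaysColorable (C : ℕ) (D M K ρ : ℝ) : Prop :=
  ∀ (V : Type u) (ι : Type v) (α : Type w) [Fintype V] [DecidableEq V] [Fintype ι] [DecidableEq ι]
    [Fintype α] [DecidableEq α] [Nonempty α] (N : ι → V → Finset V) (x : V → α → ℝ) (U : Finset V),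
    IsNearlyDisjointFamily N C D → IsWeighting N x U D M K ρ → HasWeightedColoring N x U

/-- Induction on the number `t` of rounds still needed. It is uniform in `K` because a round
replaces `K` by `4K`; as `t` does not depend on `D`, only finitely many lower bounds on `D` are
imposed. -/
lemma eventually_alwaysColorable_of_pow {C : ℕ} (hC : 1 ≤ C) {M η p : ℝ} (hM : 0 ≤ M)
    (hη0 : 0 < η) (hη1 : η < 1) (hp : p * (1 + 6 * C) = η / 4) (t : ℕ) :
    ∀ ρ : ℝ, 0 ≤ ρ → ρ ≤ 1 - η → ρ * (1 - p * η / 4) ^ t ≤ 1 / (16 * C) → ∀ K : ℝ, 1 ≤ K →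
      ∀ᶠ D : ℝ in atTop, AlwaysColorable.{u, v, w} C D M K ρ := by
  have hC' : (1 : ℝ) ≤ C := by exact_mod_cast hC
  have hp0 : 0 < p := by
    by_contra hcon
    push Not at hcon
    nlinarith
  have hpη : p ≤ η / 4 := by nlinarith
  have hsmall : ∀ ρ : ℝ, 0 ≤ ρ → ρ ≤ 1 / (16 * C) → ∀ K : ℝ,
      ∀ᶠ D : ℝ in atTop, AlwaysColorable.{u, v, w} C D M K ρ := by
    intro ρ hρ0 hρ K
    refine Eventually.of_forall fun D V ι α _ _ _ _ _ _ _ N x U hN hx => ?_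
    refine hx.hasWeightedColoring_of_small hN hρ0 ?_
    rw [le_div_iff₀ (by positivity)] at hρ
    linarith
  induction t with
  | zero =>
    intro ρ hρ0 _ hρ K _
    rw [pow_zero, mul_one] at hρ
    exact hsmall ρ hρ0 hρ K
  | succ t ih =>
    intro ρ hρ0 hρ1 hρ K hK
    by_cases hρs : ρ ≤ 1 / (16 * C)
    · exact hsmall ρ hρ0 hρs K
    push Not at hρs
    have hpη0 : 0 < p * η := by positivity
    have hpη1 : p * η ≤ 1 := by nlinarith
    -- Since `ρ` exceeds `1/(16C)` in this case, the error is small compared with the gain `ρpη`.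
    set δ := 1 / (16 * C) * (p * η) / 16 with hδ
    have hδ0 : 0 < δ := by positivity
    have hδρ : 8 * δ ≤ ρ * (p * η) := by
      rw [hδ]
      have := mul_le_mul_of_nonneg_right hρs.le hpη0.le
      nlinarith
    have hδ1 : δ ≤ 1 / 2 := by nlinarith
    have hfac0 : 0 ≤ 1 - p * η / 4 := by linarith
    have hρ'0 : 0 ≤ ρ * (1 - p * η / 4) := mul_nonneg hρ0 hfac0
    have hκ : 0 < δ ^ 2 / (24 * C * K ^ 2) := by positivity
    have hnext := ih (ρ * (1 - p * η / 4)) hρ'0 (by nlinarith)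
      (by rw [mul_assoc, ← pow_succ']; exact hρ) (4 * K) (by linarith)
    filter_upwards [hnext, eventually_ge_atTop 1, eventually_exp_div_le K p hδ0,
      eventually_local_lemma_condition C hM hκ] with D hD hD1 hexp hlll
    intro V ι α _ _ _ _ _ _ _ N x U hN hx
    have hround : IsRound N x U C D M K ρ p :=
      { family := hN
        weighting := hx
        one_le_C := hC
        one_le_D := hD1
        one_le_K := hK
        ρ_nonneg := hρ0
        ρ_le_one := by linarith
        p_nonneg := hp0.le
        p_le_one := by linarith
        rate_le := by
          have h1 : p * C ≤ 1 / 24 := by nlinarith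
          have h2 : p * (C * ρ) = p * C * ρ := by ring
          rw [h2]
          have : 0 ≤ p * C := by positivity
          nlinarith }
    obtain ⟨x', U', hnew, himp⟩ := hround.exists_next hδ0.le hδ1 hM hρ'0 (by
      rw [Real.exp_add]
      exact next_color_degree_le hη0 hη1 hp hp0 hδ0 hδρ hρ0 hρ1 hexp) hlll
    exact himp (hD V ι α N x' U' hN hnew)

/-- If the color degrees are bounded away from the total weight `1`, and all weights are at most
`1 / D`, then a coloring exists. -/
theorem eventually_alwaysColorable {C : ℕ} (hC : 1 ≤ C) {M η : ℝ} (hM : 0 ≤ M)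
    (hη0 : 0 < η) (hη1 : η < 1) :
    ∀ᶠ D : ℝ in atTop, AlwaysColorable.{u, v, w} C D M 1 (1 - η) := by
  have hC' : (1 : ℝ) ≤ C := by exact_mod_cast hC
  set p := η / 4 / (1 + 6 * C) with hp
  have hp' : p * (1 + 6 * C) = η / 4 := by
    rw [hp]
    field_simp
  have hp0 : 0 < p := by positivity
  have hpη : 0 < p * η := by positivity
  have hp1 : p ≤ 1 := by nlinarith
  obtain ⟨t, ht⟩ := exists_pow_lt_of_lt_one (show (0 : ℝ) < 1 / (16 * C) by positivity)
    (show 1 - p * η / 4 < 1 by linarith)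
  refine eventually_alwaysColorable_of_pow hC hM hη0 hη1 hp' t (1 - η) (by linarith) le_rfl ?_ 1
    le_rfl
  refine le_trans ?_ ht.le
  refine mul_le_of_le_one_left (pow_nonneg ?_ t) (by linarith)
  nlinarith

end NibbleColoring

/-! ### From lists to uniform weights. -/

namespace NibbleColoring

open Finset Filter

universe u v w

/-- Nearly disjoint families of large maximum degree `D` can be colored from lists of size
`(1 + ε) D`. -/
theorem eventually_exists_list_coloring {C : ℕ} (hC : 1 ≤ C) {ε : ℝ} (hε : 0 < ε) :
    ∀ᶠ D : ℝ in atTop, ∀ (V : Type u) (ι : Type v) (α : Type w) [Fintype V] [DecidableEq V]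
      [Fintype ι] [DecidableEq ι] (N : ι → V → Finset V), IsNearlyDisjointFamily N C D →
      ∀ L : V → Finset α, (∀ v, ⌊(1 + ε) * D⌋₊ ≤ (L v).card) →
        ∃ φ : V → α, (∀ v, φ v ∈ L v) ∧ ∀ u v, u ∈ neighbors N v → φ u ≠ φ v := by
  classical
  have hη : 1 - (1 - 1 / (1 + ε / 2)) = 1 / (1 + ε / 2) := by ring
  have hη0 : (0 : ℝ) < 1 - 1 / (1 + ε / 2) := by
    rw [sub_pos, div_lt_one (by positivity)]
    linarith
  have hη1 : 1 - 1 / (1 + ε / 2) < 1 := by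
    have : 0 < 1 / (1 + ε / 2) := by positivity
    linarith
  filter_upwards [eventually_alwaysColorable.{u, v, w} hC (M := 1 + ε) (by linarith) hη0 hη1,
    eventually_ge_atTop 1, eventually_ge_atTop (2 / ε)] with D hD hD1 hDε
  intro V ι α _ _ _ _ N hN L hL
  rcases isEmpty_or_nonempty V with hV | hV
  · exact ⟨fun v => hV.elim v, fun v => hV.elim v, fun v => hV.elim v⟩
  obtain ⟨v₀⟩ := hV
  set k := ⌊(1 + ε) * D⌋₊ with hk
  -- Rounding down loses less than 1, which is at most `εD/2`.
  have hkD : (1 + ε / 2) * D ≤ k := by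
    have h1 := Nat.lt_floor_add_one ((1 + ε) * D)
    rw [div_le_iff₀ hε] at hDε
    rw [← hk] at h1
    linarith
  have hkup : (k : ℝ) ≤ (1 + ε) * D := Nat.floor_le (by positivity)
  have hDk : D ≤ k := by nlinarith
  have hk0 : (0 : ℝ) < k := by linarith
  have hkpos : 0 < k := by exact_mod_cast hk0
  -- Lists are trimmed to exactly `k` colors, and the palette to their finite union `S`, so that
  -- uniform weights fit `IsWeighting`.
  choose L' hL'sub hL'card using fun v => exists_subset_card_eq (hL v)
  let S : Finset α := univ.biUnion L'
  have hS : ∀ v, ∀ c ∈ L' v, c ∈ S := fun v c hc => mem_biUnion.mpr ⟨v, mem_univ v, hc⟩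
  have hne : Nonempty S := by
    obtain ⟨c, hc⟩ := card_pos.mp (hL'card v₀ ▸ hkpos)
    exact ⟨c, hS v₀ c hc⟩
  let x : V → S → ℝ := fun v c => if (c : α) ∈ L' v then 1 / k else 0
  have hx0 : ∀ v c, 0 ≤ x v c := fun v c => by
    simp only [x]
    positivity
  have hxle : ∀ v c, x v c ≤ 1 / k := fun v c => by
    simp only [x]
    split_ifs
    · exact le_rfl
    · positivity
  have hcard : ∀ v, (univ.filter fun c : S => (c : α) ∈ L' v).card = k := by
    intro v
    rw [← hL'card v, ← card_map (Function.Embedding.subtype (· ∈ S))]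
    congr 1
    ext c
    simp only [Finset.mem_map, mem_filter, mem_univ, true_and, Function.Embedding.subtype_apply]
    exact ⟨fun ⟨c', h1, h2⟩ => h2 ▸ h1, fun h => ⟨⟨c, hS v c h⟩, h, rfl⟩⟩
  have hxw : IsWeighting N x univ D (1 + ε) 1 (1 - (1 - 1 / (1 + ε / 2))) := by
    refine ⟨hx0, fun v hv => absurd (mem_univ v) hv, fun v _ => ?_, fun i v c _ => ?_,
      fun v c => ?_, fun v => ?_⟩
    · simp only [x]
      rw [← sum_filter, sum_const, hcard, nsmul_eq_mul]
      field_simp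
    · rw [hη]
      refine (sum_le_card_nsmul _ _ _ fun u _ => hxle u c).trans ?_
      rw [nsmul_eq_mul]
      have h1 : ((N i v).card : ℝ) * (1 / k) ≤ D * (1 / k) := by
        have := hN.card_le i v
        gcongr
      refine h1.trans ?_
      rw [mul_one_div, div_le_div_iff₀ hk0 (by positivity)]
      linarith
    · exact (hxle v c).trans (by gcongr)
    · refine le_trans ?_ hkup
      rw [← hcard v]
      exact_mod_cast card_le_card fun c hc => by
        simp only [mem_filter, mem_univ, true_and, x] at *
        by_contra hcon
        simp [hcon] at hc
  obtain ⟨φ, hφ1, hφ2⟩ := hD V ι S N x univ hN hxw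
  refine ⟨fun v => φ v, fun v => hL'sub v ?_, fun u v huv h => ?_⟩
  · have := hφ1 v (mem_univ v)
    by_contra hcon
    simp [x, hcon] at this
  · exact hφ2 u (mem_univ u) v (mem_univ v) huv (Subtype.ext h)

end NibbleColoring

/-! ### Compactness and the passage from subgraphs to neighborhoods. -/

namespace SimpleGraph

open NibbleColoring

universe u

/-- A list assignment with nonempty lists has a coloring if this is true on all finite sets of
vertices. -/
theorem listColorable_of_finite {V : Type u} (G : SimpleGraph V) {α : Type u} (L : V → Finset α)
    (hL : ∀ v, (L v).Nonempty)
    (h : ∀ s : Finset V, ∃ φ : s → α, (∀ v : s, φ v ∈ L v) ∧ ∀ u v : s, G.Adj u v → φ u ≠ φ v) :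
    G.ListColorable L := by
  classical
  choose φ hφ1 hφ2 using h
  -- Outside `s` the value is an arbitrary list color; Rado's selection below only compares `χ` with
  -- `g t` on the endpoints of an edge, with `t` containing both.
  let g : Finset V → (v : V) → L v := fun s v =>
    if hv : v ∈ s then ⟨φ s ⟨v, hv⟩, hφ1 s ⟨v, hv⟩⟩ else ⟨(hL v).choose, (hL v).choose_spec⟩
  obtain ⟨χ, hχ⟩ := Finset.rado_selection g
  refine ⟨Coloring.mk (fun v => (χ v : α)) ?_, fun v => (χ v).2⟩
  intro u v huv heq
  obtain ⟨t, hst, ht⟩ := hχ {u, v}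
  have hu : u ∈ t := hst (by simp)
  have hv : v ∈ t := hst (by simp)
  have e1 := ht u (by simp)
  have e2 := ht v (by simp)
  rw [e1, e2] at heq
  simp only [g, hu, hv, dif_pos] at heq
  exact hφ2 t ⟨u, hu⟩ ⟨v, hv⟩ huv heq

lemma listChromaticNumber_le {V : Type u} {G : SimpleGraph V} {k : ℕ} (h : G.Choosable k) :
    G.listChromaticNumber ≤ k :=
  iInf₂_le k h

/-- The neighborhoods in a finite set of vertices of a nearly disjoint family of subgraphs. -/
lemma isNearlyDisjointFamily_of_nearlyDisjoint {V W : Type*} [Fintype W] [DecidableEq W] {m : ℕ}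
    {G : Fin m → (⊤ : SimpleGraph V).Subgraph} (f : W → V) (hf : Function.Injective f)
    (hG : NearlyDisjoint G) {D : ℝ} (hD0 : 0 ≤ D)
    (hD : ∀ i, ((G i).eMaxDegree : ℝ≥0∞) ≤ ENNReal.ofReal D) {C : ℕ}
    (hC : ∀ v ∈ ⋃ i, (G i).verts, ({i | v ∈ (G i).verts} : Set (Fin m)).ncard ≤ C)
    {N : Fin m → W → Finset W} (hN : ∀ i u v, u ∈ N i v ↔ (G i).Adj (f v) (f u)) :
    IsNearlyDisjointFamily N C D := by
  classical
  have hverts : ∀ {i v}, (N i v).Nonempty → f v ∈ (G i).verts := by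
    rintro i v ⟨u, hu⟩
    exact ((hN i u v).mp hu).fst_mem
  refine ⟨fun {i u v} h => ?_, fun i v h => ?_, fun i v => ?_, fun v => ?_,
    fun {i j u v} hij h1 h2 h3 h4 => ?_⟩
  · rw [hN] at *
    exact h.symm
  · rw [hN] at h
    exact h.ne rfl
  · rcases (N i v).eq_empty_or_nonempty with hne | hne
    · simpa [hne] using hD0
    · have h1 : ((N i v).card : ℕ∞) ≤ ((G i).neighborSet (f v)).encard := by
        rw [← Set.encard_coe_eq_coe_finsetCard, ← hf.encard_image]
        refine Set.encard_le_encard ?_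
        rintro _ ⟨u, hu, rfl⟩
        exact (hN i u v).mp hu
      have h2 : ((N i v).card : ℕ∞) ≤ (G i).eMaxDegree :=
        h1.trans (le_iSup₂ (f := fun v _ => ((G i).neighborSet v).encard) (f v) (hverts hne))
      have h3 : (((N i v).card : ℕ∞) : ℝ≥0∞) ≤ ENNReal.ofReal D :=
        (ENat.toENNReal_le.mpr h2).trans (hD i)
      rw [ENat.toENNReal_coe, ← ENNReal.ofReal_natCast] at h3
      exact (ENNReal.ofReal_le_ofReal_iff hD0).mp h3
  · by_cases hv : f v ∈ ⋃ i, (G i).verts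
    · refine le_trans ?_ (hC _ hv)
      rw [← Set.ncard_coe_finset]
      refine Set.ncard_le_ncard (fun i hi => ?_) (Set.toFinite _)
      exact hverts (by simpa using hi)
    · rw [Finset.filter_eq_empty_iff.mpr]
      · simp
      · intro i _ hi
        exact hv (Set.mem_iUnion.mpr ⟨i, hverts hi⟩)
  · refine hf (Set.encard_le_one_iff.mp (hG i j hij) _ _ ⟨hverts h1, hverts h2⟩
      ⟨hverts h3, hverts h4⟩)

end SimpleGraph

theorem theorem1p1 (C ε : ℝ) (hC : 0 < C) (hε : 0 < ε) :
    ∃ D₀ : ℝ, ∀ D : ℝ, D₀ ≤ D →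
      ∀ (V : Type*) (m : ℕ) (G : Fin m → (⊤ : SimpleGraph V).Subgraph),
        SimpleGraph.NearlyDisjoint G →
        (∀ i, ((G i).eMaxDegree : ℝ≥0∞) ≤ ENNReal.ofReal D) →
        (∀ v ∈ ⋃ i, (G i).verts, (({i | v ∈ (G i).verts} : Set (Fin m)).ncard : ℝ) ≤ C) →
        ((⨆ i, G i).coe.listChromaticNumber : ℝ≥0∞) ≤ ENNReal.ofReal ((1 + ε) * D) := by
  classical
  -- Multiplicities are integers, so `C` may be rounded down; the maximum with 1 supplies `1 ≤ C`.
  have hev := NibbleColoring.eventually_exists_list_coloring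
    (le_max_left 1 ⌊C⌋₊) hε
  obtain ⟨D₀, hD₀⟩ := Filter.eventually_atTop.mp (hev.and (Filter.eventually_ge_atTop 1))
  refine ⟨D₀, fun D hD V m G hG hdeg hmult => ?_⟩
  obtain ⟨hlist, hD1⟩ := hD₀ D hD
  have hfloor : ((⌊(1 + ε) * D⌋₊ : ℕ) : ℝ) ≤ (1 + ε) * D := Nat.floor_le (by positivity)
  have hpos : 1 ≤ ⌊(1 + ε) * D⌋₊ := Nat.le_floor (by push_cast; nlinarith)
  have hchoose : (⨆ i, G i).coe.Choosable ⌊(1 + ε) * D⌋₊ := by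
    intro α L hL
    refine SimpleGraph.listColorable_of_finite _ L
      (fun v => Finset.card_pos.mp (hpos.trans (hL v))) fun s => ?_
    let N : Fin m → s → Finset s := fun i v =>
      Finset.univ.filter fun u => (G i).Adj (v : (⨆ i, G i).verts) (u : (⨆ i, G i).verts)
    have hN := SimpleGraph.isNearlyDisjointFamily_of_nearlyDisjoint (N := N)
      (C := max 1 ⌊C⌋₊) (fun v : s => ((v : (⨆ i, G i).verts) : V))
      (Subtype.val_injective.comp Subtype.val_injective) hG (by linarith) hdeg
      (fun v hv => le_max_of_le_right (Nat.le_floor (hmult v hv))) (by simp [N])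
    obtain ⟨φ, hφ1, hφ2⟩ := hlist s (Fin m) α N hN (fun v => L v) fun v => hL v
    refine ⟨φ, hφ1, fun u v huv => hφ2 u v ?_⟩
    rw [SimpleGraph.Subgraph.coe_adj, SimpleGraph.Subgraph.iSup_adj] at huv
    obtain ⟨i, hi⟩ := huv
    exact NibbleColoring.mem_neighbors.mpr ⟨i, by simpa [N] using hi.symm⟩
  refine (ENat.toENNReal_le.mpr (SimpleGraph.listChromaticNumber_le hchoose)).trans ?_
  rw [ENat.toENNReal_coe, ← ENNReal.ofReal_natCast]
  exact ENNReal.ofReal_le_ofReal hfloor
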